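/- **Conventions.** A $\mathsf{TC}^0$ circuit family is a family of acyclic unbounded fan-in circuits of $\mathsf{MAJORITY}$ and $\neg$ gates whose depth is bounded by an absolute constant and whose size (number of gates and wires) is polynomial in the parameters. $\mathcal G_{z,2}$ is the class of integer matrices in which every row sums to $0$ and the positive entries of every row sum to a power of $2$. Such a matrix is $w$-bounded if the positive entries of each row sum to at most $2^w$; its entries are encoded in sign-magnitude form by a sign bit ($1$ for negative) and $w+1$ magnitude bits, and both representations of $0$ are accepted. A matrix is in $\mathcal{MC}_2$ if its columns are variables $x_1,\dots,x_N$ followed by $y_1,\dots,y_N$ and each row is a nonzero multiple of $x_i-x_j$, of $y_i-y_j$, or of $x_i-y_i-(x_j-y_j)$ for some $i\ne j$. **The algorithm.** Let $A\in\mathcal G_{z,2}$ be a $w$-bounded $m\times n$ matrix. Start with the columns (variables) $x_1,\dots,x_n$. For $i=1,\dots,m$, for $s=+,-$ (in this order), for $k=1,\dots,w$: while row $A_i$ has more than one entry of sign $s$ whose absolute value has $k$-th binary digit (of weight $2^{k-1}$) equal to $1$, let $j_1<j_2$ be the indices of the first two such entries, append a new variable $x_t$ (where $t-1$ is the current number of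 columns), replace $s2^{k-1}(x_{j_1}+x_{j_2})$ by $s2^k x_t$ in $A_i$ (the new column is $0$ in all other rows), and record the triple $(t,j_1,j_2)$. Let $g$ be the number of recorded triples. The $r$-th triple $(t,j_1,j_2)$ ($r=1,\dots,g$), with $t'=n+g+4(r-1)$, contributes the coefficients of the eight equations, in this order, $$x_t-x_{t'+1}=0,\quad x_{t'+2}-x_{j_2}=0,\quad y_{t'+1}-y_{t'+3}=0,\quad y_{t'+4}-y_{t'+2}=0,\quad x_{t'+3}-x_{j_1}=0,\quad x_t-x_{t'+4}=0,$$ $$x_{t'+4}-y_{t'+4}-(x_{t'+3}-y_{t'+3})=0,\qquad x_{t'+1}-y_{t'+1}-(x_{t'+2}-y_{t'+2})=0 .$$ The output $B$ is the $m'\times n'$ matrix with $m'=m+8g$ and $n'=2(n+5g)$ whose first $m$ rows are the transformed rows of $A$ (padded with zeros) and whose following rows are these equations in the order of the triples; its columns are $x_1,\dots,x_{n+5g},y_1,\dots,y_{n+5g}$. **Theorem.** There is a $\mathsf{TC}^0$ circuit family $\{C_{n,m,w}\}_{n,m,w\ge 1}$ of size $\mathrm{poly}(n,m,w)$, with $(O(nmw)+O(\log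 nmw))$-bit input and $O(w)$-bit output, such that: * the first $O(nmw)$ input bits represent an $m\times n$ matrix $A$ in sign-magnitude form, the next $O(\log nmw)$ bits represent an index $i$ and the last $O(\log nmw)$ bits an index $j$ in binary; every $w$-bounded $m\times n$ matrix in $\mathcal G_{z,2}$ can be so represented; * for every $w$-bounded $A\in\mathcal G_{z,2}$, the matrix $B$ computed by the algorithm on $A$ is in $\mathcal{MC}_2$, its dimensions satisfy $m',n'=O(nmw)$, and $m'$ and $n'$ themselves can be written with the available number of index bits; if $1\le i\le m'$ and $1\le j\le n'$, then the output of $C_{n,m,w}$ represents the entry $B_{ij}$ in sign-magnitude form, and otherwise it represents $0$. (In asymptotic bounds $O(\log nmw)$ is read as $O(1+\log nmw)$.) -/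

import Mathlib

/-! ### Threshold circuits -/

/-- A gate reading wires in `W`: negation, or unbounded fan-in majority. -/
inductive TCGate (W : Type) : Type where
  | not (a : W) : TCGate W
  | maj (l : List W) : TCGate W

namespace TCGate

variable {W : Type}

/-- The value of a gate; a majority gate is true when strictly more than half of its wires are. -/
def eval (v : W → Bool) : TCGate W → Bool
  | not a => !(v a)
  | maj l => decide (l.length < 2 * l.countP v)

/-- One more than the largest depth of a wire read by the gate. -/
def depth (d : W → ℕ) : TCGate W → ℕ
  | not a => d a + 1
  | maj l => (l.map d).foldr max 0 + 1

/-- The number of wires read by the gate, with multiplicity. -/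
def fanIn : TCGate W → ℕ
  | not _ => 1
  | maj l => l.length

end TCGate

/-- A circuit with inputs labelled by `ι` and outputs labelled by `ω`, as an acyclic network:
the gate with number `g` reads inputs and gates with a smaller number. -/
structure TCCircuit (ι ω : Type) : Type where
  numGates : ℕ
  gate : (g : Fin numGates) → TCGate (ι ⊕ Fin g)
  out : ω → ι ⊕ Fin numGates

namespace TCCircuit

variable {ι ω : Type}

/-- The value of a gate on the input `x`. -/
def gateVal (C : TCCircuit ι ω) (x : ι → Bool) (g : Fin C.numGates) : Bool :=
  (C.gate g).eval (Sum.elim x fun (a : Fin g.1) => C.gateVal x ⟨a, a.2.trans g.2⟩)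
termination_by g.1
decreasing_by exact a.2

/-- The output of the circuit on the input `x`. -/
def eval (C : TCCircuit ι ω) (x : ι → Bool) : ω → Bool :=
  fun o => Sum.elim x (C.gateVal x) (C.out o)

/-- The depth of a gate; inputs have depth `0` and every gate (also a negation) counts. -/
def gateDepth (C : TCCircuit ι ω) (g : Fin C.numGates) : ℕ :=
  (C.gate g).depth (Sum.elim (fun _ => 0) fun (a : Fin g.1) => C.gateDepth ⟨a, a.2.trans g.2⟩)
termination_by g.1
decreasing_by exact a.2

/-- The depth of the circuit: the largest depth of a gate. -/
def depth (C : TCCircuit ι ω) : ℕ :=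
  Finset.univ.sup C.gateDepth

/-- The size of the circuit: the number of gates plus the number of wires. -/
def size (C : TCCircuit ι ω) : ℕ :=
  C.numGates + ∑ g, (C.gate g).fanIn

end TCCircuit

/-! ### Classes of matrices -/

/-- Integer matrices with zero row sums in which the positive coefficients of each row add up to a
power of two. -/
def IsGz2 {m n : ℕ} (A : Matrix (Fin m) (Fin n) ℤ) : Prop :=
  ∀ i, ∑ j, A i j = 0 ∧ ∃ k : ℕ, ∑ j, max (A i j) 0 = 2 ^ k

/-- In each row the positive coefficients add up to at most `2 ^ w`. -/
def IsWBounded {m n : ℕ} (w : ℕ) (A : Matrix (Fin m) (Fin n) ℤ) : Prop :=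
  ∀ i, ∑ j, max (A i j) 0 ≤ 2 ^ w

/-- Two-commodity matrices: the columns are `N` variables `x` followed by `N` variables `y`, and
each row is a nonzero scaling of `x i - x j`, of `y i - y j`, or of `x i - y i - (x j - y j)`. -/
def IsMC2 {p q : ℕ} (B : Matrix (Fin p) (Fin q) ℤ) : Prop :=
  ∃ N : ℕ, q = 2 * N ∧ ∀ r, ∃ c : ℤ, c ≠ 0 ∧ ∃ i < N, ∃ j < N, i ≠ j ∧
    let x : ℕ → ℕ → ℤ := fun i l => if l = i then 1 else 0
    let y : ℕ → ℕ → ℤ := fun i l => if l = N + i then 1 else 0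
    ((∀ l : Fin q, B r l = c * (x i l - x j l)) ∨
     (∀ l : Fin q, B r l = c * (y i l - y j l)) ∨
     (∀ l : Fin q, B r l = c * (x i l - y i l - (x j l - y j l))))

/-! ### The pair-and-replace algorithm

Rows, columns and variables are numbered from `1`, as in the usual pseudocode. -/

/-- The variables `x 1, x 2, …` and `y 1, y 2, …`. -/
inductive MCVar : Type where
  | x (j : ℕ) : MCVar
  | y (j : ℕ) : MCVar
  deriving DecidableEq

/-- The eight equations (coefficient vectors, right hand side zero) that together
express `2 x_t = x_{j₁} + x_{j₂}`, with auxiliary variables numbered `t' + 1, …, t' + 4`. -/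
def mcGadget (t t' j₁ j₂ : ℕ) : List (MCVar → ℤ) :=
  let x : ℕ → MCVar → ℤ := fun j => Pi.single (MCVar.x j) 1
  let y : ℕ → MCVar → ℤ := fun j => Pi.single (MCVar.y j) 1
  [ x t - x (t' + 1),
    x (t' + 2) - x j₂,
    y (t' + 1) - y (t' + 3),
    y (t' + 4) - y (t' + 2),
    x (t' + 3) - x j₁,
    x t - x (t' + 4),
    x (t' + 4) - y (t' + 4) - (x (t' + 3) - y (t' + 3)),
    x (t' + 1) - y (t' + 1) - (x (t' + 2) - y (t' + 2)) ]

/-- The increasing list of the indices `j` in `1, …, cols` for which the entry `row j` has sign `s`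
and the binary digit of weight `2 ^ k` of its absolute value is `1`. -/
def bitEntries (row : ℕ → ℤ) (cols : ℕ) (s : ℤ) (k : ℕ) : List ℕ :=
  (List.range' 1 cols).filter fun j => decide ((row j).sign = s) && (row j).natAbs.testBit k

/-- Replace `s 2 ^ k (x_{j₁} + x_{j₂})` by `s 2 ^ (k + 1) x_t`. -/
def replacePair (row : ℕ → ℤ) (s : ℤ) (k t j₁ j₂ : ℕ) : ℕ → ℤ := fun j =>
  if j = t then s * 2 ^ (k + 1)
  else if j = j₁ ∨ j = j₂ then row j - s * 2 ^ k
  else row j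

/-- The working memory: the current matrix `A` (zero where it is not yet filled), the numbers
`rows` and `cols` of rows and columns, the counter `ng` of variables that occur only in the gadgets,
and the list `C` of the gadget equations added so far. -/
structure PRState : Type where
  A : ℕ → ℕ → ℤ
  rows : ℕ
  cols : ℕ
  ng : ℕ
  C : List (MCVar → ℤ)

/-- The body of the while loop, for row `i`, sign `s`, digit `k` and the pair `j₁`, `j₂`. -/
def PRState.step (S : PRState) (i : ℕ) (s : ℤ) (k j₁ j₂ : ℕ) : PRState where
  A := Function.update S.A i (replacePair (S.A i) s k (S.cols + 1) j₁ j₂)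
  rows := S.rows + 8
  cols := S.cols + 1
  ng := S.ng + 4
  C := S.C ++ mcGadget (S.cols + 1) S.ng j₁ j₂

theorem testBit_natAbs_sub {a s : ℤ} {k : ℕ} (hs : a.sign = s) (hk : a.natAbs.testBit k = true) :
    (a - s * 2 ^ k).natAbs.testBit k = false := by
  have hge : 2 ^ k ≤ a.natAbs := Nat.ge_two_pow_of_testBit hk
  obtain ⟨r, hr⟩ := Nat.exists_eq_add_of_le hge
  have hab : (a - s * 2 ^ k).natAbs = r := by
    have hpos : 0 < 2 ^ k := Nat.two_pow_pos k
    have hcast : ((2 ^ k : ℕ) : ℤ) = 2 ^ k := by push_cast; rfl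
    rw [← hcast]
    generalize 2 ^ k = q at *
    rcases lt_trichotomy a 0 with h | h | h
    · rw [Int.sign_eq_neg_one_of_neg h] at hs
      subst hs
      omega
    · subst h
      simp at hr
      omega
    · rw [Int.sign_eq_one_of_pos h] at hs
      subst hs
      omega
  rw [hr, Nat.testBit_two_pow_add_eq] at hk
  rw [hab]
  simpa using hk

theorem bitEntries_replacePair_lt {row : ℕ → ℤ} {cols : ℕ} {s : ℤ} {k j₁ j₂ : ℕ} {l : List ℕ}
    (h : bitEntries row cols s k = j₁ :: j₂ :: l) :
    (bitEntries (replacePair row s k (cols + 1) j₁ j₂) (cols + 1) s k).length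
      < (bitEntries row cols s k).length := by
  have key : bitEntries (replacePair row s k (cols + 1) j₁ j₂) (cols + 1) s k =
      (bitEntries row cols s k).filter fun j => decide (j ≠ j₁ ∧ j ≠ j₂) := by
    have hmem : ∀ j ∈ bitEntries row cols s k,
        (row j).sign = s ∧ (row j).natAbs.testBit k = true := by
      intro j hj
      simpa [bitEntries] using (List.mem_filter.1 hj).2
    have h1 := hmem j₁ (by simp [h])
    have h2 := hmem j₂ (by simp [h])
    unfold bitEntries
    rw [List.range'_1_concat, List.filter_append, List.filter_filter]
    have hnew : List.filter (fun j =>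
        decide ((replacePair row s k (cols + 1) j₁ j₂ j).sign = s) &&
          (replacePair row s k (cols + 1) j₁ j₂ j).natAbs.testBit k) [1 + cols] = [] := by
      have hs : s.natAbs = 1 ∨ s.natAbs = 0 := by
        rw [← h1.1]
        rcases lt_trichotomy (row j₁) 0 with h | h | h
        · simp [Int.sign_eq_neg_one_of_neg h]
        · simp [h]
        · simp [Int.sign_eq_one_of_pos h]
      rcases hs with hs | hs <;>
        simp [replacePair, Nat.add_comm 1 cols, Int.natAbs_mul, Int.natAbs_pow, hs]
    rw [hnew, List.append_nil]
    apply List.filter_congr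
    intro j hj
    have hjc : j ≠ cols + 1 := by
      have := List.mem_range'_1.1 hj
      omega
    by_cases e1 : j = j₁
    · subst e1
      simp [replacePair, hjc, testBit_natAbs_sub h1.1 h1.2]
    · by_cases e2 : j = j₂
      · subst e2
        simp [replacePair, hjc, testBit_natAbs_sub h2.1 h2.2]
      · simp [replacePair, hjc, e1, e2]
  rw [key, List.length_filter_lt_length_iff_exists]
  exact ⟨j₁, by simp [h], by simp⟩

/-- The while loop for row `i`, sign `s` and the digit of weight `2 ^ k`: as long as there are at
least two entries with that sign and digit, replace the first two of them. -/
def PRState.elimBit (S : PRState) (i : ℕ) (s : ℤ) (k : ℕ) : PRState :=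
  match _h : bitEntries (S.A i) S.cols s k with
  | j₁ :: j₂ :: _ => PRState.elimBit (S.step i s k j₁ j₂) i s k
  | _ => S
termination_by (bitEntries (S.A i) S.cols s k).length
decreasing_by
  simpa [PRState.step] using bitEntries_replacePair_lt _h

/-- The entries of `A` addressed by row and column numbers starting from `1`, zero elsewhere. -/
def oneBased {m n : ℕ} (A : Matrix (Fin m) (Fin n) ℤ) (i j : ℕ) : ℤ :=
  if h : (1 ≤ i ∧ i ≤ m) ∧ (1 ≤ j ∧ j ≤ n) then
    A ⟨i - 1, by omega⟩ ⟨j - 1, by omega⟩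
  else 0

/-- The three nested for loops, over the rows `i = 1, …, m`, the signs `+`, `-`, and the `w` lowest
binary digits (of weights `2 ^ 0, …, 2 ^ (w - 1)`), with `ng₀` as initial value of `ng`. -/
def prRun {m n : ℕ} (w : ℕ) (A : Matrix (Fin m) (Fin n) ℤ) (ng₀ : ℕ) : PRState :=
  (List.range' 1 m).foldl (fun S i =>
    ([1, -1] : List ℤ).foldl (fun S s =>
      (List.range w).foldl (fun S k => S.elimBit i s k) S) S)
    { A := oneBased A, rows := m, cols := n, ng := ng₀, C := [] }

/-- The number of rows of the output matrix. -/
def prRows {m n : ℕ} (w : ℕ) (A : Matrix (Fin m) (Fin n) ℤ) : ℕ :=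
  (prRun w A 0).rows

/-- The number of variables `x` (which is also the number of variables `y`) of the output matrix. -/
def prNumX {m n : ℕ} (w : ℕ) (A : Matrix (Fin m) (Fin n) ℤ) : ℕ :=
  (prRun w A 0).cols + (prRun w A 0).ng

/-- The number of columns of the output matrix. -/
def prCols {m n : ℕ} (w : ℕ) (A : Matrix (Fin m) (Fin n) ℤ) : ℕ :=
  2 * prNumX w A

/-- The output matrix. A first run gives the number of variables `x` that do not occur only in
gadgets; in a second run the gadget-only variables are numbered after these. The gadget equations
are stacked below the transformed matrix, all `x` come before all `y`, and the rest is `0`. -/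
def prMatrix {m n : ℕ} (w : ℕ) (A : Matrix (Fin m) (Fin n) ℤ) :
    Matrix (Fin (prRows w A)) (Fin (prCols w A)) ℤ := fun r q =>
  let S := prRun w A (prRun w A 0).cols
  let v : MCVar := if q.1 < prNumX w A then .x (q + 1) else .y (q - prNumX w A + 1)
  if r.1 < m then
    match v with
    | .x j => S.A (r + 1) j
    | .y _ => 0
  else S.C.getD (r - m) 0 v

/-! ### Binary encodings -/

/-- The integer with sign bit `b 0` (`true` for negative) whose absolute value has the binary digits
`b 1, b 2, …`, least significant first. -/
def signMag {p : ℕ} (b : Fin (p + 1) → Bool) : ℤ :=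
  (if b 0 then -1 else 1) * (Nat.ofBits fun k : Fin p => b k.succ : ℕ)

/-- The number of bits of an index. -/
def idxBits (n m w : ℕ) : ℕ :=
  Nat.size (32 * (n * m * w))

/-- The positions of the input bits: a sign bit and `w + 1` magnitude bits for each entry of an
`m × n` matrix, then the bits of the row index, then those of the column index. -/
abbrev PRInput (n m w : ℕ) : Type :=
  (Fin m × Fin n × Fin (w + 2)) ⊕ (Fin (idxBits n m w) ⊕ Fin (idxBits n m w))

/-- The matrix represented by the input bits. -/
def inputMatrix {n m w : ℕ} (x : PRInput n m w → Bool) : Matrix (Fin m) (Fin n) ℤ :=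
  fun i j => signMag fun b => x (.inl (i, j, b))

/-- The row index represented by the input bits (binary, least significant digit first). -/
def inputRow {n m w : ℕ} (x : PRInput n m w → Bool) : ℕ :=
  Nat.ofBits fun b => x (.inr (.inl b))

/-- The column index represented by the input bits (binary, least significant digit first). -/
def inputCol {n m w : ℕ} (x : PRInput n m w → Bool) : ℕ :=
  Nat.ofBits fun b => x (.inr (.inr b))

/-!
The parallel evaluation of the algorithm rests on the observation that its outcome has a closed form.
Split row `i` into two lines, its positive and its negative entries. In a line, the while loop for
digit `k` sees the entries of the input matrix with digit `k`, followed by the variables created by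
the loop for digit `k - 1`, and it replaces consecutive pairs of this list. So the number of pairs is
the carry out of position `k` when the absolute values of the entries of the line are added up in
binary (`carry`, `lineCarry`). Summing these numbers over all earlier loops gives the indices of the
new variables (`blockOff`), and the columns of every pair can be read off (`pairFst`, `pairSnd`).
`BlockInv` states this closed form as an invariant of the loops; it is proved from the effect of a
single loop, `elimBit_spec`.

If the entries of a line add up to `2 ^ K`, all loops for digits below `K` meet an even number of
entries, and a single entry remains, with digit `K` (`carry_of_sum_eq_two_pow`, `bitAt_final`). As the
row sums to zero, `K` is the same for both lines of a row, so the row becomes a multiple of a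
difference of two variables; together with the shape of the gadgets this gives `prMatrix_isMC2`.

For the circuits, Boolean functions are given by trees of gates of bounded depth and fan-in
(`TCComp`), which unfold to circuits of polynomial size (`TCCircuit.exists_eval_eq`). Numbers of
polynomial size are represented in unary (`TCNat`); counting, sums of polynomially many numbers, and
arbitrary functions of a fixed number of them are then of constant depth. The one quantity that is
not directly a count is the carry. A window of `O(log n)` positions below `k` determines it up to one
unit (`carryWindow_bounds`), and the missing unit is found by carry look-ahead
(`carry_lookahead`). The output bits are assembled in `tc_output` and shown to represent the entries
of the output matrix in `signMag_outBit`.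
-/

/-! ### Threshold functions of bounded depth and fan-in -/

/-- `TCComp F D f`: the Boolean function `f` is given by a tree of negation and majority gates of
depth at most `D` in which every gate has fan-in at most `F`. For bounded depth, sharing of
subcircuits is not needed to keep the size polynomial. -/
inductive TCComp {ι : Type} (F : ℕ) : ℕ → ((ι → Bool) → Bool) → Prop where
  | input (D : ℕ) (i : ι) : TCComp F D fun x => x i
  | not {D : ℕ} {f : (ι → Bool) → Bool} : TCComp F D f → TCComp F (D + 1) fun x => !f x
  | maj {D : ℕ} (l : List ((ι → Bool) → Bool)) : l.length ≤ F → (∀ f ∈ l, TCComp F D f) →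
      TCComp F (D + 1) fun x => decide (l.length < 2 * l.countP fun f => f x)
  | mono {D D' : ℕ} {f : (ι → Bool) → Bool} : D ≤ D' → TCComp F D f → TCComp F D' f

namespace TCGate

variable {W W' : Type}

/-- Relabelling of the wires of a gate. -/
def map (h : W → W') : TCGate W → TCGate W'
  | not a => not (h a)
  | maj l => maj (l.map h)

theorem eval_map (h : W → W') (v : W' → Bool) (g : TCGate W) :
    (g.map h).eval v = g.eval (v ∘ h) := by
  cases g <;> simp [map, eval, List.countP_map]

theorem depth_map (h : W → W') (d : W' → ℕ) (g : TCGate W) :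
    (g.map h).depth d = g.depth (d ∘ h) := by
  cases g <;> simp [map, depth]

theorem fanIn_map (h : W → W') (g : TCGate W) : (g.map h).fanIn = g.fanIn := by
  cases g <;> simp [map, fanIn]

end TCGate

namespace TCCircuit

variable {ι ω : Type}

/-- The value carried by a wire. -/
def wireVal (C : TCCircuit ι ω) (x : ι → Bool) : ι ⊕ Fin C.numGates → Bool :=
  Sum.elim x (C.gateVal x)

/-- The depth of a wire. -/
def wireDepth (C : TCCircuit ι ω) : ι ⊕ Fin C.numGates → ℕ :=
  Sum.elim (fun _ => 0) C.gateDepth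

/-- The circuit `C` with one more gate. -/
def snoc (C : TCCircuit ι ω) (t : TCGate (ι ⊕ Fin C.numGates)) : TCCircuit ι ω where
  numGates := C.numGates + 1
  gate g := if h : g.1 < C.numGates then C.gate ⟨g, h⟩ else
    t.map (Sum.map id (Fin.castLE (not_lt.1 h)))
  out o := (C.out o).map id Fin.castSucc

theorem gateVal_snoc (C : TCCircuit ι ω) (t : TCGate (ι ⊕ Fin C.numGates)) (x : ι → Bool)
    (g : ℕ) (hg : g < C.numGates) :
    (C.snoc t).gateVal x ⟨g, Nat.lt_succ_of_lt hg⟩ = C.gateVal x ⟨g, hg⟩ := by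
  induction g using Nat.strong_induction_on with
  | _ g ih =>
    rw [gateVal, gateVal]
    simp only [snoc, hg, dif_pos]
    congr 2
    funext a
    exact ih a a.2 (a.2.trans hg)

theorem gateDepth_snoc (C : TCCircuit ι ω) (t : TCGate (ι ⊕ Fin C.numGates))
    (g : ℕ) (hg : g < C.numGates) :
    (C.snoc t).gateDepth ⟨g, Nat.lt_succ_of_lt hg⟩ = C.gateDepth ⟨g, hg⟩ := by
  induction g using Nat.strong_induction_on with
  | _ g ih =>
    rw [gateDepth, gateDepth]
    simp only [snoc, hg, dif_pos]
    congr 2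
    funext a
    exact ih a a.2 (a.2.trans hg)

theorem gateVal_snoc_last (C : TCCircuit ι ω) (t : TCGate (ι ⊕ Fin C.numGates)) (x : ι → Bool) :
    (C.snoc t).gateVal x ⟨C.numGates, Nat.lt_succ_self _⟩ = t.eval (C.wireVal x) := by
  rw [gateVal]
  simp only [snoc, lt_irrefl, dif_neg, not_false_eq_true]
  rw [TCGate.eval_map]
  congr 1
  funext a
  rcases a with i | a
  · rfl
  · exact gateVal_snoc C t x a a.2

theorem gateDepth_snoc_last (C : TCCircuit ι ω) (t : TCGate (ι ⊕ Fin C.numGates)) :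
    (C.snoc t).gateDepth ⟨C.numGates, Nat.lt_succ_self _⟩ = t.depth C.wireDepth := by
  rw [gateDepth]
  simp only [snoc, lt_irrefl, dif_neg, not_false_eq_true]
  rw [TCGate.depth_map]
  congr 1
  funext a
  rcases a with i | a
  · rfl
  · exact gateDepth_snoc C t a a.2

theorem size_snoc (C : TCCircuit ι ω) (t : TCGate (ι ⊕ Fin C.numGates)) :
    (C.snoc t).size = C.size + 1 + t.fanIn := by
  have : ∑ g, ((C.snoc t).gate g).fanIn = ∑ g, (C.gate g).fanIn + t.fanIn := by
    change ∑ g : Fin (C.numGates + 1), ((C.snoc t).gate g).fanIn = _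
    rw [Fin.sum_univ_castSucc]
    congr 1
    · refine Finset.sum_congr rfl fun g _ => ?_
      simp [snoc]
    · simp [snoc, TCGate.fanIn_map]
  rw [size, this, size]
  simp only [snoc]
  omega

/-- `C'` contains the gates of `C` as its first gates. -/
def Extends (C' C : TCCircuit ι ω) : Prop :=
  ∃ h : C.numGates ≤ C'.numGates,
    (∀ x g, C'.gateVal x (Fin.castLE h g) = C.gateVal x g) ∧
    ∀ g, C'.gateDepth (Fin.castLE h g) = C.gateDepth g

theorem Extends.refl (C : TCCircuit ι ω) : C.Extends C := ⟨le_rfl, fun _ _ => rfl, fun _ => rfl⟩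

theorem Extends.trans {C C' C'' : TCCircuit ι ω} (h₂ : C''.Extends C') (h₁ : C'.Extends C) :
    C''.Extends C := by
  obtain ⟨h, hv, hd⟩ := h₁
  obtain ⟨h', hv', hd'⟩ := h₂
  exact ⟨h.trans h', fun x g => (hv' x (Fin.castLE h g)).trans (hv x g),
    fun g => (hd' (Fin.castLE h g)).trans (hd g)⟩

theorem snoc_extends (C : TCCircuit ι ω) (t : TCGate (ι ⊕ Fin C.numGates)) :
    (C.snoc t).Extends C :=
  ⟨Nat.le_succ _, fun x g => gateVal_snoc C t x g g.2, fun g => gateDepth_snoc C t g g.2⟩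

/-- Some wire of the circuit carries the function `f` and has depth at most `D`. -/
def Carries (C : TCCircuit ι ω) (D : ℕ) (f : (ι → Bool) → Bool) : Prop :=
  ∃ a, (∀ x, C.wireVal x a = f x) ∧ C.wireDepth a ≤ D

theorem Carries.extends {C C' : TCCircuit ι ω} {D : ℕ} {f : (ι → Bool) → Bool}
    (h : C.Carries D f) (hC : C'.Extends C) : C'.Carries D f := by
  obtain ⟨a, hv, hd⟩ := h
  obtain ⟨hle, hv', hd'⟩ := hC
  refine ⟨a.map id (Fin.castLE hle), fun x => ?_, ?_⟩
  · rw [← hv x]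
    rcases a with i | g
    · rfl
    · exact hv' x g
  · refine le_trans (le_of_eq ?_) hd
    rcases a with i | g
    · rfl
    · exact hd' g

theorem depth_snoc_le {C : TCCircuit ι ω} {t : TCGate (ι ⊕ Fin C.numGates)} {D : ℕ}
    (hC : C.depth ≤ D) (ht : t.depth C.wireDepth ≤ D) : (C.snoc t).depth ≤ D := by
  refine Finset.sup_le fun g _ => ?_
  obtain ⟨g, hg⟩ := g
  rcases Nat.lt_succ_iff_lt_or_eq.1 hg with h | h
  · rw [gateDepth_snoc C t g h]
    exact (Finset.le_sup (f := C.gateDepth) (Finset.mem_univ _)).trans hC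
  · subst h
    rw [gateDepth_snoc_last]
    exact ht

theorem exists_extends_carries_list {D K s : ℕ}
    (l : List ((ι → Bool) → Bool))
    (ih : ∀ f ∈ l, ∀ C : TCCircuit ι ω, C.depth ≤ K → ∃ C' : TCCircuit ι ω, C'.Extends C ∧
      C'.Carries D f ∧ C'.depth ≤ K ∧ C'.size ≤ C.size + s)
    (C : TCCircuit ι ω) (hC : C.depth ≤ K) :
    ∃ C' : TCCircuit ι ω, C'.Extends C ∧ (∀ f ∈ l, C'.Carries D f) ∧ C'.depth ≤ K ∧
      C'.size ≤ C.size + l.length * s := by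
  induction l generalizing C with
  | nil => exact ⟨C, .refl C, by simp, hC, by simp⟩
  | cons f l ihl =>
    obtain ⟨C₁, he₁, hc₁, hd₁, hs₁⟩ := ih f (by simp) C hC
    obtain ⟨C₂, he₂, hc₂, hd₂, hs₂⟩ := ihl (fun f hf => ih f (by simp [hf])) C₁ hd₁
    refine ⟨C₂, he₂.trans he₁, ?_, hd₂, ?_⟩
    · intro f' hf'
      rcases List.mem_cons.1 hf' with rfl | hf'
      · exact hc₁.extends he₂
      · exact hc₂ f' hf'
    · rw [List.length_cons, Nat.succ_mul]
      omega

theorem exists_wires {C : TCCircuit ι ω} {D : ℕ} (l : List ((ι → Bool) → Bool))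
    (h : ∀ f ∈ l, C.Carries D f) :
    ∃ ws : List (ι ⊕ Fin C.numGates), ws.length = l.length ∧ (∀ a ∈ ws, C.wireDepth a ≤ D) ∧
      ∀ x, ws.countP (C.wireVal x) = l.countP fun f => f x := by
  induction l with
  | nil => exact ⟨[], by simp⟩
  | cons f l ih =>
    obtain ⟨ws, h₁, h₂, h₃⟩ := ih fun f hf => h f (by simp [hf])
    obtain ⟨a, ha, hd⟩ := h f (by simp)
    refine ⟨a :: ws, by simp [h₁], List.forall_mem_cons.2 ⟨hd, h₂⟩, fun x => ?_⟩
    rw [List.countP_cons, List.countP_cons, h₃, ha]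

/-- A function given by a tree of gates can be added to any circuit. A tree of depth `D` and
fan-in `F` contributes fewer than `(2 * F + 3) ^ D` gates and wires. -/
theorem exists_extends_carries {F K D : ℕ} {f : (ι → Bool) → Bool} (hf : TCComp F D f)
    (hDK : D ≤ K) (C : TCCircuit ι ω) (hC : C.depth ≤ K) :
    ∃ C' : TCCircuit ι ω, C'.Extends C ∧ C'.Carries D f ∧ C'.depth ≤ K ∧
      C'.size ≤ C.size + ((2 * F + 3) ^ D - 1) := by
  induction hf generalizing C with
  | input D i => exact ⟨C, .refl C, ⟨.inl i, fun _ => rfl, by simp [wireDepth]⟩, hC, by simp⟩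
  | @not D f _ ih =>
    obtain ⟨C₁, he, ⟨a, hv, hd⟩, hd₁, hs⟩ := ih (by omega) C hC
    refine ⟨C₁.snoc (.not a), (C₁.snoc_extends _).trans he,
      ⟨.inr ⟨C₁.numGates, Nat.lt_succ_self _⟩, fun x => ?_, ?_⟩, depth_snoc_le hd₁ ?_, ?_⟩
    · simp only [wireVal, Sum.elim_inr, gateVal_snoc_last, TCGate.eval]
      rw [← hv x]; rfl
    · simp only [wireDepth, Sum.elim_inr, gateDepth_snoc_last, TCGate.depth]
      exact Nat.succ_le_succ hd
    · simp only [TCGate.depth]; omega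
    · rw [size_snoc, TCGate.fanIn]
      have h1 : 1 ≤ (2 * F + 3) ^ D := Nat.one_le_pow _ _ (by omega)
      have h2 : (2 * F + 3) ^ (D + 1) = 2 * F * (2 * F + 3) ^ D + 3 * (2 * F + 3) ^ D := by ring
      omega
  | @maj D l hl _ ih =>
    obtain ⟨C₁, he, hc, hd₁, hs⟩ := exists_extends_carries_list l
      (fun f hf C hC => ih f hf (by omega) C hC) C hC
    obtain ⟨ws, hlen, hwd, hcount⟩ := exists_wires l hc
    have hdep : TCGate.depth C₁.wireDepth (.maj ws) ≤ D + 1 := by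
      simp only [TCGate.depth, add_le_add_iff_right]
      clear hlen hcount
      induction ws with
      | nil => simp
      | cons a ws ih' => simpa using ⟨hwd a (by simp), ih' fun b hb => hwd b (by simp [hb])⟩
    refine ⟨C₁.snoc (.maj ws), (C₁.snoc_extends _).trans he,
      ⟨.inr ⟨C₁.numGates, Nat.lt_succ_self _⟩, fun x => ?_, ?_⟩, depth_snoc_le hd₁ ?_, ?_⟩
    · simp only [wireVal, Sum.elim_inr, gateVal_snoc_last, TCGate.eval]
      rw [hlen, ← hcount x]; rfl
    · simp only [wireDepth, Sum.elim_inr, gateDepth_snoc_last]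
      exact hdep
    · omega
    · rw [size_snoc, TCGate.fanIn, hlen]
      have h1 : 1 ≤ (2 * F + 3) ^ D := Nat.one_le_pow _ _ (by omega)
      obtain ⟨q, hq⟩ := Nat.exists_eq_add_of_le h1
      have h2 : l.length * ((2 * F + 3) ^ D - 1) ≤ F * q := by
        rw [hq, Nat.add_sub_cancel_left]; exact Nat.mul_le_mul_right _ hl
      have h3 : (2 * F + 3) ^ (D + 1) = F * q + (F * q + 2 * F + 3 * q) + 3 := by
        rw [pow_succ, hq]; ring
      omega
  | mono hDD _ ih =>
    obtain ⟨C₁, he, ⟨a, hv, hd⟩, hd₁, hs⟩ := ih (by omega) C hC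
    refine ⟨C₁, he, ⟨a, hv, hd.trans hDD⟩, hd₁, hs.trans ?_⟩
    exact Nat.add_le_add_left (Nat.sub_le_sub_right (Nat.pow_le_pow_right (by omega) hDD) 1) _

/-- Functions given by trees of depth `D` and fan-in `F` are computed by one circuit. -/
theorem exists_eval_eq {F D N : ℕ} {f : Fin N → (ι → Bool) → Bool}
    (hf : ∀ o, TCComp F D (f o)) :
    ∃ C : TCCircuit ι (Fin N), (∀ x o, C.eval x o = f o x) ∧ C.depth ≤ D ∧
      C.size ≤ N * (2 * F + 3) ^ D := by
  obtain ⟨C, _, hc, hd, hs⟩ := exists_extends_carries_list (K := D) (List.ofFn f)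
    (fun g hg C hC => by
      obtain ⟨o, rfl⟩ := (List.mem_ofFn' f g).1 hg
      exact exists_extends_carries (hf o) le_rfl C hC)
    (⟨0, fun g => g.elim0, Empty.elim⟩ : TCCircuit ι Empty) (Finset.sup_le fun g => g.elim0)
  have hout : ∀ o, ∃ a, ∀ x, C.wireVal x a = f o x := fun o => by
    obtain ⟨a, ha, _⟩ := hc (f o) ((List.mem_ofFn' f _).2 ⟨o, rfl⟩)
    exact ⟨a, ha⟩
  choose a ha using hout
  have hval : ∀ x g, (⟨C.numGates, C.gate, a⟩ : TCCircuit ι (Fin N)).gateVal x g =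
      C.gateVal x g := by
    rintro x ⟨g, hg⟩
    induction g using Nat.strong_induction_on with
    | _ g ih =>
      rw [gateVal, gateVal]
      congr 2
      funext b
      exact ih b b.2 (b.2.trans hg)
  have hdep : ∀ g, (⟨C.numGates, C.gate, a⟩ : TCCircuit ι (Fin N)).gateDepth g =
      C.gateDepth g := by
    rintro ⟨g, hg⟩
    induction g using Nat.strong_induction_on with
    | _ g ih =>
      rw [gateDepth, gateDepth]
      congr 2
      funext b
      exact ih b b.2 (b.2.trans hg)
  refine ⟨⟨C.numGates, C.gate, a⟩, fun x o => ?_, ?_, ?_⟩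
  · rw [← ha o x, eval, wireVal]
    congr 1
    funext g
    exact hval x g
  · exact (le_of_eq (Finset.sup_congr rfl fun g _ => hdep g)).trans hd
  · change C.size ≤ _
    refine hs.trans ?_
    rw [List.length_ofFn]
    simp only [size, Finset.univ_eq_empty, Finset.sum_empty, zero_add]
    exact Nat.mul_le_mul_left _ (Nat.sub_le _ _)

end TCCircuit

/-! ### Closure properties of functions of bounded depth and fan-in -/

namespace TCComp

variable {ι α : Type} {F D D' : ℕ} {f g : (ι → Bool) → Bool}

theorem congr (h : TCComp F D f) (hfg : ∀ x, f x = g x) : TCComp F D g := funext hfg ▸ h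

theorem false : TCComp F (D + 1) fun _ : ι → Bool => Bool.false :=
  (TCComp.maj (D := D) [] (by simp) (by simp)).congr (by simp)

theorem const (b : Bool) : TCComp F (D + 2) fun _ : ι → Bool => b := by
  cases b
  · exact .false
  · exact (TCComp.not (D := D + 1) .false).congr (by simp)

/-- Comparing a count with a constant: the wires of the majority gate are padded with constants. -/
theorem le_countP {l : List α} {p : α → (ι → Bool) → Bool} (hp : ∀ a ∈ l, TCComp F D (p a))
    (hF : 4 * l.length + 2 ≤ F) (t : ℕ) :
    TCComp F (D + 3) fun x => decide (t ≤ l.countP fun a => p a x) := by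
  rcases Nat.eq_zero_or_pos t with rfl | ht
  · exact (TCComp.const (D := D + 1) true).congr (by simp)
  rcases Nat.lt_or_ge l.length t with hlt | hle
  · refine (TCComp.const (D := D + 1) Bool.false).congr fun x => ?_
    have := List.countP_le_length (l := l) (p := fun a => p a x)
    simp; omega
  -- With `N` wires, `N` constants `true` and `2 * t - 1` constants `false`, a count of `c` is a
  -- strict majority iff `2 * (N + c) > 2 * N + 2 * t - 1`, that is, iff `t ≤ c`.
  refine (TCComp.maj (D := D + 2) (l.map p ++ (List.replicate l.length (fun _ => true) ++
    List.replicate (2 * t - 1) (fun _ => Bool.false))) ?_ ?_).congr fun x => ?_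
  · simp; omega
  · intro f hf
    rcases List.mem_append.1 hf with hf | hf
    · obtain ⟨a, ha, rfl⟩ := List.mem_map.1 hf
      exact (hp a ha).mono (by omega)
    · rcases List.mem_append.1 hf with hf | hf <;>
      · rw [List.eq_of_mem_replicate hf]
        exact .const _
  · simp only [List.length_append, List.length_map, List.length_replicate, List.countP_append,
      List.countP_map, List.countP_replicate, Function.comp_def, if_true]
    rw [decide_eq_decide]
    simp
    omega

theorem any {l : List α} {p : α → (ι → Bool) → Bool} (hp : ∀ a ∈ l, TCComp F D (p a))
    (hF : 4 * l.length + 2 ≤ F) : TCComp F (D + 3) fun x => l.any fun a => p a x :=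
  (le_countP hp hF 1).congr fun x => by
    rw [Bool.eq_iff_iff, decide_eq_true_iff, Nat.one_le_iff_ne_zero, Nat.ne_zero_iff_zero_lt,
      List.countP_pos_iff, List.any_eq_true]

theorem all {l : List α} {p : α → (ι → Bool) → Bool} (hp : ∀ a ∈ l, TCComp F D (p a))
    (hF : 4 * l.length + 2 ≤ F) : TCComp F (D + 3) fun x => l.all fun a => p a x :=
  (le_countP hp hF l.length).congr fun x => by
    rw [Bool.eq_iff_iff, decide_eq_true_iff, List.all_eq_true]
    rw [← List.countP_eq_length]
    exact ⟨fun h => le_antisymm List.countP_le_length h, fun h => h.ge⟩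

theorem or (hf : TCComp F D f) (hg : TCComp F D' g) (hF : 10 ≤ F) :
    TCComp F (max D D' + 3) fun x => f x || g x :=
  (any (l := [f, g]) (p := fun f => f) (D := max D D') (by
    simpa using ⟨hf.mono (le_max_left _ _), hg.mono (le_max_right _ _)⟩) (by simpa)).congr
    (by simp)

theorem and (hf : TCComp F D f) (hg : TCComp F D' g) (hF : 10 ≤ F) :
    TCComp F (max D D' + 3) fun x => f x && g x :=
  (all (l := [f, g]) (p := fun f => f) (D := max D D') (by
    simpa using ⟨hf.mono (le_max_left _ _), hg.mono (le_max_right _ _)⟩) (by simpa)).congr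
    (by simp)

end TCComp

/-- The number `φ x` is computed in unary: there is a tree for each of the tests `φ x = a`. -/
def TCNat {ι : Type} (F D : ℕ) (φ : (ι → Bool) → ℕ) : Prop :=
  ∀ a, TCComp F D fun x => decide (φ x = a)

theorem countP_lt_range {v N : ℕ} (h : v ≤ N) :
    (List.range N).countP (fun u => decide (u < v)) = v := by
  induction N with
  | zero => simp; omega
  | succ N ih =>
    rw [List.range_succ, List.countP_append, List.countP_singleton]
    rcases Nat.lt_or_ge N v with h' | h'
    · obtain rfl : v = N + 1 := by omega
      have : (List.range N).countP (fun u => decide (u < N + 1)) = (List.range N).length :=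
        List.countP_eq_length.2 fun u hu => by simpa using (List.mem_range.1 hu).le
      rw [this]
      simp
    · simp [ih h', Nat.not_lt.2 h']

namespace TCNat

variable {ι α : Type} {F D D' : ℕ} {φ : (ι → Bool) → ℕ}

theorem mono (hD : D ≤ D') (h : TCNat F D φ) : TCNat F D' φ := fun a => (h a).mono hD

theorem congr {ψ : (ι → Bool) → ℕ} (h : TCNat F D φ) (hφ : ∀ x, φ x = ψ x) : TCNat F D ψ :=
  funext hφ ▸ h

/-- Substitution of a small number for a parameter: a disjunction over its possible values. -/
theorem bindBool {V : ℕ} {ψ : ℕ → (ι → Bool) → Bool} (hφ : TCNat F D φ) (hV : ∀ x, φ x < V)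
    (hψ : ∀ v < V, TCComp F D' (ψ v)) (hF : 4 * V + 10 ≤ F) :
    TCComp F (max D D' + 6) fun x => ψ (φ x) x := by
  refine (TCComp.any (l := List.range V) (p := fun v x => decide (φ x = v) && ψ v x)
    (fun v hv => (hφ v).and (hψ v (List.mem_range.1 hv)) (by omega))
    (by rw [List.length_range]; omega)).congr fun x => ?_
  rw [Bool.eq_iff_iff, List.any_eq_true]
  constructor
  · rintro ⟨v, _, hv⟩
    simp only [Bool.and_eq_true, decide_eq_true_eq] at hv
    obtain ⟨rfl, hv⟩ := hv
    exact hv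
  · intro h
    exact ⟨φ x, List.mem_range.2 (hV x), by simpa using h⟩

theorem bind {V : ℕ} {ψ : ℕ → (ι → Bool) → ℕ} (hφ : TCNat F D φ) (hV : ∀ x, φ x < V)
    (hψ : ∀ v < V, TCNat F D' (ψ v)) (hF : 4 * V + 10 ≤ F) :
    TCNat F (max D D' + 6) fun x => ψ (φ x) x :=
  fun a => bindBool (ψ := fun v x => decide (ψ v x = a)) hφ hV (fun v hv => hψ v hv a) hF

theorem testBool {V : ℕ} (hφ : TCNat F D φ) (hV : ∀ x, φ x < V) (hF : 4 * V + 10 ≤ F)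
    (h : ℕ → Bool) : TCComp F (max D 2 + 6) fun x => h (φ x) :=
  bindBool (ψ := fun v _ => h v) (D' := 2) hφ hV (fun _ _ => .const (D := 0) _) hF

theorem comp {V : ℕ} (hφ : TCNat F D φ) (hV : ∀ x, φ x < V) (hF : 4 * V + 10 ≤ F)
    (h : ℕ → ℕ) : TCNat F (max D 2 + 6) fun x => h (φ x) :=
  fun a => testBool hφ hV hF fun v => decide (h v = a)

theorem testBool₂ {V V' : ℕ} {ψ : (ι → Bool) → ℕ} (hφ : TCNat F D φ) (hV : ∀ x, φ x < V)
    (hψ : TCNat F D' ψ) (hV' : ∀ x, ψ x < V') (hF : 4 * V + 10 ≤ F) (hF' : 4 * V' + 10 ≤ F)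
    (h : ℕ → ℕ → Bool) : TCComp F (max D (max D' 2 + 6) + 6) fun x => h (φ x) (ψ x) :=
  bindBool (ψ := fun v x => h v (ψ x)) hφ hV (fun v _ => hψ.testBool hV' hF' (h v)) hF

theorem comp₂ {V V' : ℕ} {ψ : (ι → Bool) → ℕ} (hφ : TCNat F D φ) (hV : ∀ x, φ x < V)
    (hψ : TCNat F D' ψ) (hV' : ∀ x, ψ x < V') (hF : 4 * V + 10 ≤ F) (hF' : 4 * V' + 10 ≤ F)
    (h : ℕ → ℕ → ℕ) : TCNat F (max D (max D' 2 + 6) + 6) fun x => h (φ x) (ψ x) :=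
  fun a => testBool₂ hφ hV hψ hV' hF hF' fun u v => decide (h u v = a)

theorem countP {l : List α} {p : α → (ι → Bool) → Bool} (hp : ∀ a ∈ l, TCComp F D (p a))
    (hF : 4 * l.length + 10 ≤ F) : TCNat F (D + 7) fun x => l.countP fun a => p a x := by
  intro t
  refine (((TCComp.le_countP hp (by omega) t).and
    (TCComp.le_countP hp (by omega) (t + 1)).not (by omega)).mono ?_).congr fun x => ?_
  · omega
  · rw [Bool.eq_iff_iff]
    simp
    omega

/-- A sum of few small numbers is a count of pairs. -/
theorem sum {N M : ℕ} {φ : ℕ → (ι → Bool) → ℕ} (hφ : ∀ i < N, TCNat F D (φ i))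
    (hM : ∀ i < N, ∀ x, φ i x ≤ M) (hF : 4 * (N * M) + 10 ≤ F) (hF' : 4 * (M + 1) + 10 ≤ F) :
    TCNat F (max D 2 + 13) fun x => ∑ i ∈ Finset.range N, φ i x := by
  refine (countP (l := List.range N ×ˢ List.range M) (p := fun q x => decide (q.2 < φ q.1 x))
    (D := max D 2 + 6) (fun q hq => ?_) ?_).congr fun x => ?_
  · have h1 := List.mem_range.1 (List.mem_product.1 hq).1
    exact (hφ _ h1).testBool (fun x => Nat.lt_succ_of_le (hM _ h1 x)) hF' fun v => decide (q.2 < v)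
  · rw [List.length_product, List.length_range, List.length_range]; exact hF
  · clear hφ hF
    induction N with
    | zero => simp
    | succ N ih =>
      rw [Finset.sum_range_succ, ← ih fun i hi => hM i (by omega)]
      simp only [List.range_succ, SProd.sprod, List.product, List.flatMap_append, List.countP_append,
        List.flatMap_singleton, List.countP_map, Function.comp_def, add_right_inj]
      exact countP_lt_range (hM N (by omega) x)

end TCNat

/-! ### Carries of an iterated addition -/

/-- The carry into position `k` when `o l` units of weight `2 ^ l` are added up, for every `l`. -/
def carry (o : ℕ → ℕ) : ℕ → ℕ
  | 0 => 0
  | k + 1 => (o k + carry o k) / 2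

/-- The contribution of the `L` positions below `k`, scaled by `2 ^ (L - k)`. -/
def carryWindow (o : ℕ → ℕ) (L k : ℕ) : ℕ :=
  ∑ l ∈ Finset.range k, o l * if k ≤ l + L then 2 ^ (l + L - k) else 0

theorem carry_le {o : ℕ → ℕ} {n : ℕ} (ho : ∀ l, o l ≤ n) (k : ℕ) : carry o k ≤ n := by
  induction k with
  | zero => simp [carry]
  | succ k ih => have := ho k; rw [carry]; omega

theorem carry_eq (o : ℕ → ℕ) (k : ℕ) : carry o k = (∑ l ∈ Finset.range k, o l * 2 ^ l) / 2 ^ k := by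
  induction k with
  | zero => simp [carry]
  | succ k ih =>
    rw [carry, ih, Finset.sum_range_succ, pow_succ, ← Nat.div_div_eq_div_mul,
      Nat.add_mul_div_right _ _ (Nat.two_pow_pos k), Nat.add_comm]

/-- The window determines the carry up to one unit. -/
theorem carryWindow_bounds {o : ℕ → ℕ} {n L : ℕ} (ho : ∀ l, o l ≤ n) (hL : n < 2 ^ L) (k : ℕ) :
    carryWindow o L k / 2 ^ L ≤ carry o k ∧ carry o k ≤ carryWindow o L k / 2 ^ L + 1 := by
  -- `Z` collects the contribution of the positions below the window.
  obtain ⟨Z, hZ, hZlt⟩ : ∃ Z, (∑ l ∈ Finset.range k, o l * 2 ^ l) * 2 ^ L =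
      carryWindow o L k * 2 ^ k + Z ∧ Z < 2 ^ L * 2 ^ k := by
    refine ⟨∑ l ∈ Finset.range k, o l * if k ≤ l + L then 0 else 2 ^ (l + L), ?_, ?_⟩
    · rw [carryWindow, Finset.sum_mul, Finset.sum_mul, ← Finset.sum_add_distrib]
      refine Finset.sum_congr rfl fun l _ => ?_
      split_ifs with h
      · rw [mul_assoc, mul_assoc, ← pow_add, ← pow_add, Nat.sub_add_cancel h]; simp
      · rw [mul_assoc, ← pow_add]; simp
    · have : ∀ j ≤ k, (∑ l ∈ Finset.range j, o l * if k ≤ l + L then 0 else 2 ^ (l + L)) + n ≤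
          n * 2 ^ min (j + L) k := by
        intro j
        induction j with
        | zero => intro _; simpa using Nat.le_mul_of_pos_right n (Nat.two_pow_pos _)
        | succ j ih =>
          intro hj
          have := ih (by omega)
          rw [Finset.sum_range_succ]
          split_ifs with h
          · rw [min_eq_right h] at this
            rw [min_eq_right (by omega)]
            omega
          · rw [min_eq_left (by omega)] at this ⊢
            have h2 := Nat.mul_le_mul_right (2 ^ (j + L)) (ho j)
            have h3 : n * 2 ^ (j + 1 + L) = n * 2 ^ (j + L) + n * 2 ^ (j + L) := by ring
            omega
      have h := this k le_rfl
      rw [min_eq_right (by omega)] at h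
      have h2 : n * 2 ^ k < 2 ^ L * 2 ^ k := Nat.mul_lt_mul_of_pos_right hL (Nat.two_pow_pos k)
      omega
  have hk := Nat.two_pow_pos k
  have hL' := Nat.two_pow_pos L
  rw [carry_eq]
  constructor
  · rw [Nat.le_div_iff_mul_le hk]
    refine Nat.le_of_mul_le_mul_right (?_ : _ * 2 ^ L ≤ _ * 2 ^ L) hL'
    have := Nat.mul_le_mul_right (2 ^ k) (Nat.div_mul_le_self (carryWindow o L k) (2 ^ L))
    rw [mul_right_comm, hZ]
    omega
  · rw [← Nat.add_div_right _ hL', Nat.le_div_iff_mul_le hL']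
    refine Nat.le_of_mul_le_mul_right (?_ : _ * 2 ^ k ≤ _ * 2 ^ k) hk
    have := Nat.mul_le_mul_right (2 ^ L)
      (Nat.div_mul_le_self (∑ l ∈ Finset.range k, o l * 2 ^ l) (2 ^ k))
    rw [mul_right_comm, Nat.add_mul]
    omega

/-- Carry look-ahead: the remaining unit is present iff it is generated at some position and
propagated by all positions after it. -/
theorem carry_lookahead {o q : ℕ → ℕ} (hq0 : q 0 = 0)
    (hq : ∀ k, q k ≤ carry o k ∧ carry o k ≤ q k + 1) (k : ℕ) :
    decide (q k < carry o k) = (List.range k).any fun i => decide (q (i + 1) < (o i + q i) / 2) &&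
      (List.range k).all fun l => decide (l ≤ i) || decide (q (l + 1) < (o l + q l + 1) / 2) := by
  rw [Bool.eq_iff_iff]
  simp only [decide_eq_true_eq, List.any_eq_true, List.mem_range, Bool.and_eq_true,
    List.all_eq_true, Bool.or_eq_true]
  induction k with
  | zero => simp [carry, hq0]
  | succ k ih =>
    have h1 := hq k
    have h2 := hq (k + 1)
    constructor
    · intro h
      rcases Nat.lt_or_ge (q k) (carry o k) with hk | hk
      · obtain ⟨i, hi, hG, hH⟩ := ih.1 hk
        refine ⟨i, by omega, hG, fun l hl => ?_⟩
        rcases Nat.lt_succ_iff_lt_or_eq.1 hl with hl | rfl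
        · exact hH l hl
        · rw [carry] at h
          right; omega
      · refine ⟨k, by omega, ?_, fun l hl => .inl (by omega)⟩
        rw [carry] at h
        omega
    · rintro ⟨i, hi, hG, hH⟩
      rw [carry]
      rcases Nat.lt_succ_iff_lt_or_eq.1 hi with hi' | rfl
      · have := ih.2 ⟨i, hi', hG, fun l hl => hH l (by omega)⟩
        have h3 := (hH k (by omega)).resolve_left (by omega)
        omega
      · omega

/-- If the total is `2 ^ K`, every position below `K` holds an even number of units, so that nothing
is left there, position `K` holds one unit, and the positions above `K` are empty. -/
theorem carry_of_sum_eq_two_pow {o : ℕ → ℕ} {N K : ℕ}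
    (h : ∑ l ∈ Finset.range N, o l * 2 ^ l = 2 ^ K) :
    (∀ l < K, l < N → Even (o l + carry o l)) ∧ (K < N → o K + carry o K = 1) ∧
      ∀ l, K < l → l < N → o l + carry o l = 0 := by
  have hsplit : ∀ k ≤ N, ∃ T, (∑ l ∈ Finset.range k, o l * 2 ^ l) + 2 ^ k * T = 2 ^ K := by
    intro k hk
    obtain ⟨d, rfl⟩ := Nat.exists_eq_add_of_le hk
    refine ⟨∑ i ∈ Finset.range d, o (k + i) * 2 ^ i, ?_⟩
    rw [← h, Finset.sum_range_add, Finset.mul_sum]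
    congr 1
    exact Finset.sum_congr rfl fun i _ => by rw [pow_add]; ring
  have hdvd : ∀ k ≤ N, k ≤ K → carry o k * 2 ^ k = ∑ l ∈ Finset.range k, o l * 2 ^ l := by
    intro k hk hkK
    obtain ⟨T, hT⟩ := hsplit k hk
    rw [carry_eq]
    refine Nat.div_mul_cancel ((Nat.dvd_add_left (Dvd.intro _ rfl)).1 (hT ▸ pow_dvd_pow 2 hkK))
  have hnext : ∀ k < N, k ≤ K →
      (o k + carry o k) * 2 ^ k = ∑ l ∈ Finset.range (k + 1), o l * 2 ^ l := by
    intro k hk hkK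
    rw [Nat.add_mul, hdvd k hk.le hkK, Finset.sum_range_succ, Nat.add_comm]
  have hpowK := Nat.two_pow_pos K
  have hK : K < N → o K + carry o K = 1 := by
    intro hKN
    obtain ⟨T, hT⟩ := hsplit (K + 1) hKN
    rw [← hnext K hKN le_rfl] at hT
    have hT0 : T = 0 := by
      by_contra h0
      have : 2 ^ (K + 1) * 1 ≤ 2 ^ (K + 1) * T := Nat.mul_le_mul_left _ (Nat.pos_of_ne_zero h0)
      rw [pow_succ] at this
      rw [pow_succ] at hT
      omega
    rw [hT0, Nat.mul_zero, Nat.add_zero] at hT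
    exact Nat.eq_of_mul_eq_mul_right hpowK (by rw [hT, Nat.one_mul])
  refine ⟨fun l hl hlN => ?_, hK, fun l hl hlN => ?_⟩
  · obtain ⟨T, hT⟩ := hsplit (l + 1) hlN
    have hd : 2 ^ (l + 1) ∣ (o l + carry o l) * 2 ^ l := by
      rw [hnext l hlN hl.le]
      exact (Nat.dvd_add_left (Dvd.intro _ rfl)).1 (hT ▸ pow_dvd_pow 2 hl)
    rw [pow_succ, Nat.mul_comm] at hd
    exact even_iff_two_dvd.2 (Nat.dvd_of_mul_dvd_mul_right (Nat.two_pow_pos l) hd)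
  · obtain ⟨T, hT⟩ := hsplit (l + 1) hlN
    have hpow : 2 ^ K < 2 ^ l := Nat.pow_lt_pow_right (by omega) hl
    rw [Finset.sum_range_succ] at hT
    have hol : o l = 0 := by
      by_contra h0
      have := Nat.le_mul_of_pos_left (2 ^ l) (Nat.pos_of_ne_zero h0)
      omega
    rw [hol, carry_eq, Nat.div_eq_of_lt (by omega)]

/-! ### Signed binary digits -/

/-- The integer `v` has sign `s` and the binary digit of weight `2 ^ l` of its absolute value is
`1`. -/
def bitAt (v s : ℤ) (l : ℕ) : Bool := decide (v.sign = s) && v.natAbs.testBit l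

theorem bitAt_zero (s : ℤ) (l : ℕ) : bitAt 0 s l = false := by simp [bitAt]

theorem bitAt_mul {s s' : ℤ} (hs : s = 1 ∨ s = -1) (N l : ℕ) :
    bitAt (s * N) s' l = (decide (s' = s) && N.testBit l) := by
  rcases Nat.eq_zero_or_pos N with rfl | hN
  · simp [bitAt]
  · have hN' : (N : ℤ).sign = 1 := Int.sign_eq_one_of_pos (by exact_mod_cast hN)
    have : (s * N).natAbs = N := by rcases hs with rfl | rfl <;> simp
    have h2 : (s * N).sign = s := by
      rw [Int.sign_mul, hN']
      rcases hs with rfl | rfl <;> rfl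
    rw [bitAt, h2, this]
    congr 1
    rw [decide_eq_decide]
    exact eq_comm

theorem bitAt_two_pow {s s' : ℤ} (hs : s = 1 ∨ s = -1) (k l : ℕ) :
    bitAt (s * 2 ^ k) s' l = (decide (s' = s) && decide (l = k)) := by
  have := bitAt_mul (s' := s') hs (2 ^ k) l
  rw [Nat.cast_pow, Nat.cast_two, Nat.testBit_two_pow] at this
  rw [this]
  congr 1
  rw [decide_eq_decide]
  exact eq_comm

theorem testBit_sub_two_pow {N k : ℕ} (h : N.testBit k = true) (l : ℕ) :
    (N - 2 ^ k).testBit l = (N.testBit l && !decide (l = k)) := by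
  induction k generalizing N l with
  | zero =>
    have h1 : N % 2 = 1 := by simpa [Nat.testBit_zero] using h
    cases l with
    | zero => simp only [Nat.testBit_zero, pow_zero]; simp; omega
    | succ l =>
      rw [Nat.testBit_succ, Nat.testBit_succ, pow_zero, show (N - 1) / 2 = N / 2 by omega]
      simp
  | succ k ih =>
    rw [Nat.testBit_succ] at h
    have hle := Nat.ge_two_pow_of_testBit h
    rw [pow_succ]
    cases l with
    | zero =>
      simp only [Nat.testBit_zero]
      rw [show (N - 2 ^ k * 2) % 2 = N % 2 by omega]
      simp
    | succ l =>
      rw [Nat.testBit_succ, show (N - 2 ^ k * 2) / 2 = N / 2 - 2 ^ k by omega, ih h,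
        Nat.testBit_succ]
      simp

theorem bitAt_sub {v s s' : ℤ} {k : ℕ} (hs : s = 1 ∨ s = -1) (h : bitAt v s k = true) (l : ℕ) :
    bitAt (v - s * 2 ^ k) s' l = (bitAt v s' l && !(decide (s' = s) && decide (l = k))) := by
  rw [bitAt, Bool.and_eq_true, decide_eq_true_eq] at h
  obtain ⟨h1, h2⟩ := h
  have hv : v = s * (v.natAbs : ℕ) := by rw [← h1, Int.sign_mul_natAbs]
  have hle := Nat.ge_two_pow_of_testBit h2
  generalize v.natAbs = N at *
  subst hv
  have : s * (N : ℤ) - s * 2 ^ k = s * ((N - 2 ^ k : ℕ) : ℤ) := by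
    rw [Nat.cast_sub hle]; push_cast; ring
  rw [this, bitAt_mul hs, bitAt_mul hs, testBit_sub_two_pow h2]
  by_cases h' : s' = s <;> simp [h']

theorem eq_of_bitAt_eq {u v : ℤ} (h : ∀ s, s = 1 ∨ s = -1 → ∀ l, bitAt u s l = bitAt v s l) :
    u = v := by
  have key : ∀ {u v : ℤ}, (∀ s, s = 1 ∨ s = -1 → ∀ l, bitAt u s l = bitAt v s l) → u ≠ 0 →
      u = v := by
    intro u v h hu
    have hs : u.sign = 1 ∨ u.sign = -1 := by
      rcases lt_or_gt_of_ne hu with h | h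
      · exact .inr (Int.sign_eq_neg_one_of_neg h)
      · exact .inl (Int.sign_eq_one_of_pos h)
    obtain ⟨l, hl⟩ := Nat.exists_testBit_of_ne_zero (Int.natAbs_ne_zero.2 hu)
    have hsign : v.sign = u.sign := by
      have := h _ hs l
      rw [bitAt, hl, bitAt] at this
      simp only [decide_true, Bool.and_self] at this
      exact of_decide_eq_true (Bool.and_eq_true _ _ ▸ this.symm).1
    have habs : u.natAbs = v.natAbs := Nat.eq_of_testBit_eq fun l => by
      have := h _ hs l
      simpa [bitAt, hsign] using this
    rw [← Int.sign_mul_natAbs u, ← hsign, habs, Int.sign_mul_natAbs]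
  by_cases hu : u = 0
  · by_cases hv : v = 0
    · rw [hu, hv]
    · exact (key (fun s hs l => (h s hs l).symm) hv).symm
  · exact key h hu

theorem bitEntries_eq (row : ℕ → ℤ) (cols : ℕ) (s : ℤ) (k : ℕ) :
    bitEntries row cols s k = (List.range' 1 cols).filter fun j => bitAt (row j) s k := rfl

theorem mem_bitEntries {row : ℕ → ℤ} {cols : ℕ} {s : ℤ} {k j : ℕ} :
    j ∈ bitEntries row cols s k ↔ (1 ≤ j ∧ j ≤ cols) ∧ bitAt (row j) s k = true := by
  rw [bitEntries_eq, List.mem_filter, List.mem_range'_1]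
  simp only [and_congr_left_iff]
  omega

theorem bitEntries_nodup (row : ℕ → ℤ) (cols : ℕ) (s : ℤ) (k : ℕ) :
    (bitEntries row cols s k).Nodup := List.Nodup.filter _ List.nodup_range'

/-! ### The effect of one while loop -/

/-- The effect of replacing one pair on the signed binary digits of a row. -/
theorem bitAt_replacePair {row : ℕ → ℤ} {s s' : ℤ} {k t j₁ j₂ : ℕ} (hs : s = 1 ∨ s = -1)
    (h₁ : bitAt (row j₁) s k = true) (h₂ : bitAt (row j₂) s k = true) (ht : row t = 0)
    (j l : ℕ) :
    bitAt (replacePair row s k t j₁ j₂ j) s' l =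
      if s' = s then
        if l = k then bitAt (row j) s l && !(decide (j = j₁) || decide (j = j₂))
        else bitAt (row j) s l || (decide (l = k + 1) && decide (j = t))
      else bitAt (row j) s' l := by
  have hne : ∀ j', bitAt (row j') s k = true → j' ≠ t := by
    rintro j' h rfl
    rw [ht, bitAt_zero] at h
    exact Bool.noConfusion h
  unfold replacePair
  by_cases hjt : j = t
  · subst hjt
    rw [if_pos rfl, bitAt_two_pow hs, ht]
    by_cases hs' : s' = s <;> by_cases hl : l = k <;> simp [hs', hl, bitAt_zero]
  rw [if_neg hjt]
  by_cases hj : j = j₁ ∨ j = j₂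
  · rw [if_pos hj, bitAt_sub hs (by rcases hj with rfl | rfl <;> assumption)]
    by_cases hs' : s' = s
    · subst hs'
      by_cases hl : l = k
      · rcases hj with rfl | rfl <;> simp [hl]
      · simp [hl, hjt]
    · simp [hs']
  · rw [if_neg hj]
    rw [not_or] at hj
    by_cases hs' : s' = s
    · subst hs'
      by_cases hl : l = k <;> simp [hl, hj.1, hj.2, hjt]
    · simp [hs']

theorem bitEntries_replacePair {row : ℕ → ℤ} {cols : ℕ} {s : ℤ} {k j₁ j₂ : ℕ} {l : List ℕ}
    (hs : s = 1 ∨ s = -1) (ht : row (cols + 1) = 0)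
    (h : bitEntries row cols s k = j₁ :: j₂ :: l) :
    bitEntries (replacePair row s k (cols + 1) j₁ j₂) (cols + 1) s k = l := by
  have h₁ := (mem_bitEntries.1 (h ▸ by simp : j₁ ∈ bitEntries row cols s k)).2
  have h₂ := (mem_bitEntries.1 (h ▸ by simp : j₂ ∈ bitEntries row cols s k)).2
  have hnd := bitEntries_nodup row cols s k
  rw [h] at hnd
  have : (j₁ :: j₂ :: l).filter (fun j => !(decide (j = j₁) || decide (j = j₂))) = l := by
    simp only [List.nodup_cons, List.mem_cons, not_or] at hnd
    simp only [List.filter_cons, decide_true, Bool.true_or, Bool.or_true, Bool.not_true]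
    simp only [Bool.false_eq_true, if_false]
    refine List.filter_eq_self.2 fun j hj => ?_
    have e₁ : j ≠ j₁ := fun e => hnd.1.2 (e ▸ hj)
    have e₂ : j ≠ j₂ := fun e => hnd.2.1 (e ▸ hj)
    simp [e₁, e₂]
  rw [← this, ← h, bitEntries_eq, bitEntries_eq, List.filter_filter, List.range'_1_concat,
    List.filter_append]
  have hlast : [1 + cols].filter
      (fun j => bitAt (replacePair row s k (cols + 1) j₁ j₂ j) s k) = [] := by
    simp [bitAt_replacePair hs h₁ h₂ ht, Nat.add_comm 1, ht, bitAt_zero]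
  rw [hlast, List.append_nil]
  refine List.filter_congr fun j _ => ?_
  rw [bitAt_replacePair hs h₁ h₂ ht, if_pos rfl, if_pos rfl, Bool.and_comm]

/-- The state `S'` arises from `S` by replacing consecutive pairs from the list `L` of entries of
row `i` with sign `s` and digit `k`; at most the last entry of `L` is left over. -/
structure ElimSpec (S S' : PRState) (i : ℕ) (s : ℤ) (k : ℕ) (L : List ℕ) : Prop where
  rows : S'.rows = S.rows + 8 * (L.length / 2)
  cols : S'.cols = S.cols + L.length / 2
  ng : S'.ng = S.ng + 4 * (L.length / 2)
  C : S'.C = S.C ++ (List.range (L.length / 2)).flatMap fun u =>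
    mcGadget (S.cols + u + 1) (S.ng + 4 * u) (L.getD (2 * u) 0) (L.getD (2 * u + 1) 0)
  other : ∀ i', i' ≠ i → S'.A i' = S.A i'
  supp : ∀ j, S'.A i j ≠ 0 → 1 ≤ j ∧ j ≤ S'.cols
  bits : ∀ j s' l, bitAt (S'.A i j) s' l =
    if s' = s then
      if l = k then decide (j ∈ L.drop (2 * (L.length / 2)))
      else bitAt (S.A i j) s l || (decide (l = k + 1) && decide (S.cols < j ∧ j ≤ S'.cols))
    else bitAt (S.A i j) s' l

theorem elimBit_spec (S : PRState) (i : ℕ) {s : ℤ} (hs : s = 1 ∨ s = -1) (k : ℕ)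
    (hsupp : ∀ j, S.A i j ≠ 0 → 1 ≤ j ∧ j ≤ S.cols) :
    ElimSpec S (S.elimBit i s k) i s k (bitEntries (S.A i) S.cols s k) := by
  induction hN : (bitEntries (S.A i) S.cols s k).length using Nat.strong_induction_on
    generalizing S with
  | _ N ih =>
    rw [PRState.elimBit]
    split
    · next j₁ j₂ l h =>
      have h₁ := mem_bitEntries.1 (h ▸ by simp : j₁ ∈ bitEntries (S.A i) S.cols s k)
      have h₂ := mem_bitEntries.1 (h ▸ by simp : j₂ ∈ bitEntries (S.A i) S.cols s k)
      have ht : S.A i (S.cols + 1) = 0 := by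
        by_contra h0
        have := hsupp _ h0
        omega
      have hbit := fun s' => bitAt_replacePair (s' := s') hs h₁.2 h₂.2 ht
      have hA : (S.step i s k j₁ j₂).A i = replacePair (S.A i) s k (S.cols + 1) j₁ j₂ := by
        simp [PRState.step]
      have hcols : (S.step i s k j₁ j₂).cols = S.cols + 1 := rfl
      have hL : bitEntries ((S.step i s k j₁ j₂).A i) (S.step i s k j₁ j₂).cols s k = l := by
        rw [hA, hcols]
        exact bitEntries_replacePair hs ht h
      have hlen : (j₁ :: j₂ :: l).length / 2 = l.length / 2 + 1 := by
        simp only [List.length_cons]; omega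
      have key := ih l.length (by rw [← hN, h]; simp only [List.length_cons]; omega)
        (S.step i s k j₁ j₂) (by
          intro j hj
          rw [hcols]
          rw [hA] at hj
          by_cases hj0 : S.A i j = 0
          · unfold replacePair at hj
            split_ifs at hj with e1 e2
            · omega
            · rcases e2 with rfl | rfl <;> omega
            · exact absurd hj0 hj
          · have := hsupp j hj0
            omega) (by rw [hL])
      rw [hL] at key
      rw [h]
      refine ⟨?_, ?_, ?_, ?_, ?_, key.supp, ?_⟩
      · rw [key.rows, hlen]; simp only [PRState.step]; ring
      · rw [key.cols, hlen, hcols]; ring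
      · rw [key.ng, hlen]; simp only [PRState.step]; ring
      · rw [key.C, hlen, List.range_succ_eq_map]
        simp only [PRState.step, List.flatMap_cons, List.append_assoc, List.flatMap_map]
        congr 2
        refine List.flatMap_congr fun u _ => ?_
        rw [show 2 * u.succ = 2 * u + 1 + 1 by omega, List.getD_cons_succ, List.getD_cons_succ,
          List.getD_cons_succ, List.getD_cons_succ]
        congr 1 <;> omega
      · intro i' hi'
        rw [key.other i' hi']
        simp [PRState.step, hi']
      · intro j s' l'
        have hdrop : (j₁ :: j₂ :: l).drop (2 * (l.length / 2 + 1)) =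
            l.drop (2 * (l.length / 2)) := by
          rw [show 2 * (l.length / 2 + 1) = 2 * (l.length / 2) + 1 + 1 by omega,
            List.drop_succ_cons, List.drop_succ_cons]
        have hc : (S.step i s k j₁ j₂).cols + l.length / 2 = S.cols + (l.length / 2 + 1) := by
          rw [hcols]; omega
        rw [key.bits, hA, hlen, hdrop, hbit, hcols, key.cols, hc]
        by_cases hs' : s' = s
        · subst hs'
          by_cases hl : l' = k
          · simp [hl]
          · simp only [if_true, hl, if_false]
            by_cases hl' : l' = k + 1
            · simp only [hl', decide_true, Bool.true_and, Bool.or_assoc]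
              congr 1
              rw [Bool.eq_iff_iff]
              simp
              omega
            · simp [hl']
        · rw [if_neg hs', if_neg hs', hbit, if_neg hs']
    · next hshort =>
      have hlen : (bitEntries (S.A i) S.cols s k).length < 2 := by
        rcases h : bitEntries (S.A i) S.cols s k with _ | ⟨j₁, _ | ⟨j₂, l⟩⟩
        · simp
        · simp
        · exact (hshort _ _ _ h).elim
      have h0 : (bitEntries (S.A i) S.cols s k).length / 2 = 0 := by omega
      refine ⟨by rw [h0]; rfl, by rw [h0]; rfl, by rw [h0]; rfl, by simp [h0], fun _ _ => rfl,
        hsupp, fun j s' l' => ?_⟩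
      by_cases hs' : s' = s
      · subst hs'
        rw [if_pos rfl, h0, Nat.mul_zero, List.drop_zero]
        by_cases hl : l' = k
        · subst hl
          rw [if_pos rfl, Bool.eq_iff_iff, decide_eq_true_iff, mem_bitEntries]
          refine ⟨fun hb => ⟨hsupp j fun h0 => ?_, hb⟩, fun hb => hb.2⟩
          rw [h0, bitAt_zero] at hb
          exact Bool.noConfusion hb
        · rw [if_neg hl]
          simp
      · rw [if_neg hs']

/-! ### Closed form of the algorithm

The rows are split into lines: line `r` consists of the entries of row `r / 2 + 1` of one sign. The
while loop for line `r` and digit `k` is block `r * w + k`. -/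

/-- The sign handled by line `r`. -/
def lineSign (r : ℕ) : ℤ := if r % 2 = 0 then 1 else -1

theorem lineSign_eq (r : ℕ) : lineSign r = 1 ∨ lineSign r = -1 := by
  unfold lineSign; split_ifs <;> simp

section ClosedForm

variable (a : ℕ → ℕ → ℤ) (n m w : ℕ)

/-- The columns of the input matrix that take part in line `r` with digit `k`. -/
def lineEntries (r k : ℕ) : List ℕ := bitEntries (a (r / 2 + 1)) n (lineSign r) k

/-- The number of variables with coefficient `± 2 ^ k` that are created in line `r`: the carry into
position `k` when the absolute values of the entries of the line are added up. -/
def lineCarry (r k : ℕ) : ℕ := carry (fun l => (lineEntries a n r l).length) k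

/-- The number of pairs replaced in block `b`. -/
def blockLen (b : ℕ) : ℕ := lineCarry a n (b / w) (b % w + 1)

/-- The number of pairs replaced before block `b`. -/
def blockOff (b : ℕ) : ℕ := ∑ c ∈ Finset.range b, blockLen a n w c

/-- The columns with digit `k` in line `r` at the beginning of block `r * w + k`: those of the input
matrix, then the variables created in the block before (none for `k = 0`). -/
def levelEntries (r k : ℕ) : List ℕ :=
  lineEntries a n r k ++ List.range' (n + blockOff a n w (r * w + k - 1) + 1) (lineCarry a n r k)

/-- The block in which pair number `ρ` (counted from `0`) is replaced. -/
def pairBlock (ρ : ℕ) : ℕ :=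
  (List.range (2 * m * w)).countP fun b => decide (blockOff a n w (b + 1) ≤ ρ)

/-- Entry `v` of the list of columns of block `b`. -/
def blockEntry (b v : ℕ) : ℕ := (levelEntries a n w (b / w) (b % w)).getD v 0

/-- The first column of pair number `ρ`. -/
def pairFst (ρ : ℕ) : ℕ :=
  blockEntry a n w (pairBlock a n m w ρ) (2 * (ρ - blockOff a n w (pairBlock a n m w ρ)))

/-- The second column of pair number `ρ`. -/
def pairSnd (ρ : ℕ) : ℕ :=
  blockEntry a n w (pairBlock a n m w ρ) (2 * (ρ - blockOff a n w (pairBlock a n m w ρ)) + 1)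

/-- The gadget of pair number `ρ`, with `ng₀` as initial value of the counter. -/
def pairGadget (ng₀ ρ : ℕ) : List (MCVar → ℤ) :=
  mcGadget (n + ρ + 1) (ng₀ + 4 * ρ) (pairFst a n m w ρ) (pairSnd a n m w ρ)

/-- The columns with digit `l` in line `r` when the digits below `k` have been processed. -/
def digitList (r k l : ℕ) : List ℕ :=
  if l < k then (levelEntries a n w r l).drop (2 * lineCarry a n r (l + 1))
  else if l = k then levelEntries a n w r l
  else lineEntries a n r l

/-- The state of the algorithm before block `b`. Of line `r`, the digits below
`min (b - r * w) w` have been processed; the truncated difference is `0` for a line that has not been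
reached. -/
structure BlockInv (ng₀ b : ℕ) (S : PRState) : Prop where
  rows : S.rows = m + 8 * blockOff a n w b
  cols : S.cols = n + blockOff a n w b
  ng : S.ng = ng₀ + 4 * blockOff a n w b
  C : S.C = (List.range (blockOff a n w b)).flatMap (pairGadget a n m w ng₀)
  supp : ∀ i j, S.A i j ≠ 0 → 1 ≤ j ∧ j ≤ S.cols
  bits : ∀ r < 2 * m, ∀ j l, bitAt (S.A (r / 2 + 1) j) (lineSign r) l =
    decide (j ∈ digitList a n w r (min (b - r * w) w) l)

variable {a n m w}

theorem lineCarry_zero (r : ℕ) : lineCarry a n r 0 = 0 := rfl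

theorem length_levelEntries (r k : ℕ) :
    (levelEntries a n w r k).length = (lineEntries a n r k).length + lineCarry a n r k := by
  simp [levelEntries]

theorem length_levelEntries_div (r k : ℕ) :
    (levelEntries a n w r k).length / 2 = lineCarry a n r (k + 1) := by
  rw [length_levelEntries]; rfl

theorem blockOff_succ (b : ℕ) : blockOff a n w (b + 1) = blockOff a n w b + blockLen a n w b :=
  Finset.sum_range_succ _ _

theorem blockOff_mono : Monotone (blockOff a n w) :=
  monotone_nat_of_le_succ fun b => by rw [blockOff_succ]; omega

theorem pairBlock_eq {b ρ : ℕ} (hb : b < 2 * m * w) (h₁ : blockOff a n w b ≤ ρ)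
    (h₂ : ρ < blockOff a n w (b + 1)) : pairBlock a n m w ρ = b := by
  rw [pairBlock, ← countP_lt_range hb.le]
  refine List.countP_congr fun c _ => ?_
  simp only [decide_eq_true_eq]
  constructor
  · intro h
    by_contra hc
    have := blockOff_mono (a := a) (n := n) (w := w) (show b + 1 ≤ c + 1 by omega)
    omega
  · intro h
    have := blockOff_mono (a := a) (n := n) (w := w) (show c + 1 ≤ b by omega)
    omega

theorem mem_lineEntries {r k j : ℕ} :
    j ∈ lineEntries a n r k ↔ (1 ≤ j ∧ j ≤ n) ∧ bitAt (a (r / 2 + 1) j) (lineSign r) k = true :=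
  mem_bitEntries

theorem levelEntries_sorted (r k : ℕ) : (levelEntries a n w r k).Pairwise (· < ·) := by
  refine List.pairwise_append.2 ⟨List.Pairwise.filter _ List.pairwise_lt_range',
    List.pairwise_lt_range', fun x hx y hy => ?_⟩
  have h1 := (mem_lineEntries.1 hx).1
  have h2 := List.mem_range'_1.1 hy
  omega

theorem levelEntries_bounds {r k j : ℕ} (hj : j ∈ levelEntries a n w r k) (hk : k ≤ w) :
    1 ≤ j ∧ j ≤ n + blockOff a n w (r * w + k) := by
  rcases List.mem_append.1 hj with hj | hj
  · have := (mem_lineEntries.1 hj).1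
    omega
  · have h2 := List.mem_range'_1.1 hj
    rcases Nat.eq_zero_or_pos k with rfl | hk0
    · rw [lineCarry_zero] at h2; omega
    · obtain ⟨k, rfl⟩ : ∃ k', k = k' + 1 := ⟨k - 1, by omega⟩
      have hb : blockLen a n w (r * w + k) = lineCarry a n r (k + 1) := by
        rw [blockLen, Nat.mul_comm, Nat.mul_add_div (by omega), Nat.mul_add_mod,
          Nat.mod_eq_of_lt (by omega), Nat.div_eq_of_lt (by omega), Nat.add_zero]
      rw [← Nat.add_assoc, blockOff_succ, hb]
      rw [← Nat.add_assoc, Nat.add_sub_cancel] at h2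
      omega

/-- Both lists are increasing, so the list read off from the row is determined by its members; hence
the loop meets the entries in the order of `levelEntries`. -/
theorem bitEntries_eq_levelEntries {row : ℕ → ℤ} {cols r k : ℕ}
    (hrow : ∀ j, row j ≠ 0 → 1 ≤ j ∧ j ≤ cols)
    (h : ∀ j, bitAt (row j) (lineSign r) k = decide (j ∈ levelEntries a n w r k)) :
    bitEntries row cols (lineSign r) k = levelEntries a n w r k := by
  refine List.Perm.eq_of_pairwise' (r := (· < ·)) (List.Pairwise.filter _ List.pairwise_lt_range')
    (levelEntries_sorted r k) ?_
  refine (List.perm_ext_iff_of_nodup (bitEntries_nodup _ _ _ _)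
    ((levelEntries_sorted r k).imp fun h => h.ne)).2 fun j => ?_
  rw [mem_bitEntries, h, decide_eq_true_iff]
  refine ⟨fun h => h.2, fun hj => ⟨hrow j fun h0 => ?_, hj⟩⟩
  have := h j
  rw [h0, bitAt_zero, decide_eq_true hj] at this
  exact Bool.noConfusion this

/-- The invariant holds for the input matrix. -/
theorem BlockInv.init {ng₀ : ℕ} {S : PRState} (hA : S.A = a) (hr : S.rows = m) (hc : S.cols = n)
    (hng : S.ng = ng₀) (hC : S.C = []) (hsupp : ∀ i j, a i j ≠ 0 → 1 ≤ j ∧ j ≤ n) :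
    BlockInv a n m w ng₀ 0 S := by
  refine ⟨by simp [blockOff, hr], by simp [blockOff, hc], by simp [blockOff, hng],
    by simp [blockOff, hC], by rwa [hA, hc], fun r _ j l => ?_⟩
  have : digitList a n w r (min (0 - r * w) w) l = lineEntries a n r l := by
    rw [Nat.zero_sub, Nat.zero_min, digitList, if_neg (Nat.not_lt_zero l)]
    split_ifs with h
    · subst h
      simp [levelEntries, lineCarry_zero]
    · rfl
  rw [this, hA, Bool.eq_iff_iff, decide_eq_true_iff, mem_lineEntries]
  refine ⟨fun h => ⟨hsupp (r / 2 + 1) j fun h0 => ?_, h⟩, fun h => h.2⟩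
  rw [h0, bitAt_zero] at h
  exact Bool.noConfusion h

/-- Each while loop takes the invariant to the next block. -/
theorem BlockInv.step {ng₀ r k : ℕ} {S : PRState} (h : BlockInv a n m w ng₀ (r * w + k) S)
    (hr : r < 2 * m) (hk : k < w) :
    BlockInv a n m w ng₀ (r * w + k + 1) (S.elimBit (r / 2 + 1) (lineSign r) k) := by
  have hmin : min (r * w + k - r * w) w = k := by omega
  have hmin' : min (r * w + k + 1 - r * w) w = k + 1 := by omega
  have hL : bitEntries (S.A (r / 2 + 1)) S.cols (lineSign r) k = levelEntries a n w r k := by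
    refine bitEntries_eq_levelEntries (h.supp _) fun j => ?_
    rw [h.bits r hr, hmin, digitList, if_neg (lt_irrefl k), if_pos rfl]
  have key := elimBit_spec S (r / 2 + 1) (lineSign_eq r) k (h.supp _)
  rw [hL] at key
  have hdiv : (r * w + k) / w = r := by
    rw [Nat.mul_comm, Nat.mul_add_div (by omega), Nat.div_eq_of_lt hk, Nat.add_zero]
  have hmod : (r * w + k) % w = k := by
    rw [Nat.mul_comm, Nat.mul_add_mod, Nat.mod_eq_of_lt hk]
  have hlen : (levelEntries a n w r k).length / 2 = blockLen a n w (r * w + k) := by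
    rw [length_levelEntries_div, blockLen, hdiv, hmod]
  have hcols := key.cols
  rw [hlen] at hcols
  refine ⟨?_, ?_, ?_, ?_, fun i j hj => ?_, fun r' hr' j l => ?_⟩
  · rw [key.rows, h.rows, hlen, blockOff_succ]; ring
  · rw [key.cols, h.cols, hlen, blockOff_succ]; ring
  · rw [key.ng, h.ng, hlen, blockOff_succ]; ring
  · rw [key.C, h.C, hlen, blockOff_succ, List.range_add, List.flatMap_append, List.flatMap_map]
    congr 1
    refine List.flatMap_congr fun u hu => ?_
    have hb : pairBlock a n m w (blockOff a n w (r * w + k) + u) = r * w + k := by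
      refine pairBlock_eq ?_ (Nat.le_add_right _ _) ?_
      · calc r * w + k < (r + 1) * w := by rw [Nat.succ_mul]; omega
          _ ≤ 2 * m * w := Nat.mul_le_mul_right _ hr
      · rw [blockOff_succ]
        have := List.mem_range.1 hu
        omega
    rw [pairGadget, pairFst, pairSnd, hb, blockEntry, blockEntry, hdiv, hmod,
      Nat.add_sub_cancel_left, h.cols, h.ng]
    congr 1 <;> ring
  · by_cases hi : i = r / 2 + 1
    · subst hi
      exact key.supp j hj
    · rw [key.other i hi] at hj
      have := h.supp i j hj
      omega
  · by_cases hrr : r' = r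
    · subst hrr
      rw [key.bits, if_pos rfl, h.bits _ hr', hmin, hmin', length_levelEntries_div]
      unfold digitList
      rcases lt_trichotomy l k with hl | rfl | hl
      · simp [hl, hl.ne, Nat.lt_succ_of_lt hl]
        omega
      · simp
      · rw [if_neg hl.ne', if_neg (by omega), if_neg hl.ne', if_neg (by omega)]
        by_cases hl' : l = k + 1
        · subst hl'
          rw [if_pos rfl, levelEntries, hcols, h.cols]
          simp only [decide_true, Bool.true_and, List.mem_append, Bool.decide_or,
            List.mem_range'_1]
          congr 1
          rw [decide_eq_decide, ← Nat.add_assoc, Nat.add_sub_cancel, blockLen, hdiv, hmod]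
          omega
        · simp [hl']
    · have hmineq : min (r * w + k + 1 - r' * w) w = min (r * w + k - r' * w) w := by
        rcases Nat.lt_or_gt_of_ne hrr with hlt | hgt
        · have := Nat.mul_le_mul_right w hlt
          rw [Nat.succ_mul] at this
          omega
        · have := Nat.mul_le_mul_right w hgt
          rw [Nat.succ_mul] at this
          omega
      rw [hmineq, ← h.bits r' hr']
      by_cases hrow : r' / 2 = r / 2
      · rw [hrow, key.bits, if_neg]
        unfold lineSign
        split_ifs <;> first | omega | decide
      · rw [key.other _ (by omega)]

theorem BlockInv.levels {ng₀ r : ℕ} {S : PRState} (h : BlockInv a n m w ng₀ (r * w) S)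
    (hr : r < 2 * m) {k : ℕ} (hk : k ≤ w) :
    BlockInv a n m w ng₀ (r * w + k)
      ((List.range k).foldl (fun S k => S.elimBit (r / 2 + 1) (lineSign r) k) S) := by
  induction k with
  | zero => simpa using h
  | succ k ih =>
    rw [List.range_succ, List.foldl_append]
    exact (ih (by omega)).step hr (by omega)

theorem BlockInv.lines {ng₀ : ℕ} {S : PRState} (h : BlockInv a n m w ng₀ 0 S) {i : ℕ}
    (hi : i ≤ m) :
    BlockInv a n m w ng₀ (2 * i * w) ((List.range' 1 i).foldl (fun S i =>
      ([1, -1] : List ℤ).foldl (fun S s =>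
        (List.range w).foldl (fun S k => S.elimBit i s k) S) S) S) := by
  induction i with
  | zero => simpa using h
  | succ i ih =>
    rw [List.range'_1_concat, List.foldl_append]
    have h1 := (ih (by omega)).levels (by omega) le_rfl
    rw [← Nat.succ_mul] at h1
    have h2 := h1.levels (by omega) le_rfl
    rw [← Nat.succ_mul] at h2
    have e1 : (2 * i) / 2 + 1 = 1 + i := by omega
    have e2 : (2 * i).succ / 2 + 1 = 1 + i := by omega
    have e3 : lineSign (2 * i) = 1 := by simp [lineSign]
    have e4 : lineSign (2 * i).succ = -1 := by simp [lineSign]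
    rw [e1, e2, e3, e4] at h2
    exact h2

end ClosedForm

theorem oneBased_supp {m n : ℕ} (A : Matrix (Fin m) (Fin n) ℤ) (i j : ℕ)
    (h : oneBased A i j ≠ 0) : 1 ≤ j ∧ j ≤ n := by
  unfold oneBased at h
  split_ifs at h with h'
  · exact h'.2
  · exact absurd rfl h

/-- For a state that has passed all blocks, the invariant is a closed form of the run. -/
theorem prRun_inv {m n : ℕ} (w : ℕ) (A : Matrix (Fin m) (Fin n) ℤ) (ng₀ : ℕ) :
    BlockInv (oneBased A) n m w ng₀ (2 * m * w) (prRun w A ng₀) :=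
  (BlockInv.init (S := { A := oneBased A, rows := m, cols := n, ng := ng₀, C := [] })
    rfl rfl rfl rfl rfl (oneBased_supp A)).lines le_rfl

/-! ### The output matrix for rows with power-of-two sums -/

theorem countP_range'_one (p : ℕ → Bool) (n : ℕ) :
    (List.range' 1 n).countP p = ∑ j : Fin n, if p (j + 1) then 1 else 0 := by
  rw [Fin.sum_univ_eq_sum_range (fun j => if p (j + 1) then 1 else 0) n]
  induction n with
  | zero => simp
  | succ n ih =>
    rw [List.range'_1_concat, List.countP_append, ih, Finset.sum_range_succ, List.countP_singleton,
      Nat.add_comm 1]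

theorem sum_testBit (x N : ℕ) :
    (∑ l ∈ Finset.range N, if x.testBit l then 2 ^ l else 0) = x % 2 ^ N := by
  induction N with
  | zero => simp [Nat.mod_one]
  | succ N ih =>
    rw [Finset.sum_range_succ, ih, Nat.mod_pow_succ, Nat.testBit_eq_decide_div_mod_eq]
    rcases Nat.mod_two_eq_zero_or_one (x / 2 ^ N) with h | h <;> simp [h]

theorem sum_bitAt {v s : ℤ} (hs : s = 1 ∨ s = -1) {N : ℕ} (hv : v.natAbs < 2 ^ N) :
    ((∑ l ∈ Finset.range N, if bitAt v s l then 2 ^ l else 0 : ℕ) : ℤ) = max (s * v) 0 := by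
  by_cases h : v.sign = s
  · have : ∀ l, bitAt v s l = v.natAbs.testBit l := fun l => by simp [bitAt, h]
    simp only [this]
    rw [sum_testBit, Nat.mod_eq_of_lt hv, ← h, Int.sign_mul_self_eq_natAbs]
    exact (max_eq_left (by omega)).symm
  · have : ∀ l, bitAt v s l = false := fun l => by simp [bitAt, h]
    simp only [this]
    rw [max_eq_right]
    · simp
    · rcases lt_trichotomy v 0 with h0 | h0 | h0
      · rw [Int.sign_eq_neg_one_of_neg h0] at h
        rcases hs with rfl | rfl <;> omega
      · subst h0; simp
      · rw [Int.sign_eq_one_of_pos h0] at h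
        rcases hs with rfl | rfl <;> omega

theorem oneBased_succ {m n : ℕ} (A : Matrix (Fin m) (Fin n) ℤ) (i : Fin m) (j : Fin n) :
    oneBased A (i + 1) (j + 1) = A i j := by
  unfold oneBased
  rw [dif_pos ⟨⟨by omega, by omega⟩, by omega, by omega⟩]
  rfl

section Line

variable {m n w : ℕ} {A : Matrix (Fin m) (Fin n) ℤ}

theorem sum_neg_part (hA : IsGz2 A) (i : Fin m) : ∑ j, max (-A i j) 0 = ∑ j, max (A i j) 0 := by
  have h := (hA i).1
  rw [← sub_eq_zero, ← Finset.sum_sub_distrib, ← neg_eq_zero, ← Finset.sum_neg_distrib, ← h]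
  exact Finset.sum_congr rfl fun j _ => by omega

theorem natAbs_le (hA : IsGz2 A) (hw : IsWBounded w A) (i : Fin m) (j : Fin n) :
    (A i j).natAbs ≤ 2 ^ w := by
  have h1 : max (A i j) 0 ≤ ∑ j, max (A i j) 0 :=
    Finset.single_le_sum (f := fun j => max (A i j) 0) (fun j _ => le_max_right _ _)
      (Finset.mem_univ j)
  have h2 : max (-A i j) 0 ≤ ∑ j, max (-A i j) 0 :=
    Finset.single_le_sum (f := fun j => max (-A i j) 0) (fun j _ => le_max_right _ _)
      (Finset.mem_univ j)
  rw [sum_neg_part hA] at h2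
  have h3 := hw i
  zify
  rcases abs_cases (A i j) with h | h <;> omega

theorem natAbs_lt (hA : IsGz2 A) (hw : IsWBounded w A) (i : Fin m) (j : Fin n) :
    (A i j).natAbs < 2 ^ (w + 1) :=
  (natAbs_le hA hw i j).trans_lt (Nat.pow_lt_pow_right (by omega) (by omega))

/-- The entries of row `i` of either sign add up to the same power of two. -/
theorem exists_line_sum (hA : IsGz2 A) (hw : IsWBounded w A) (i : Fin m) :
    ∃ K ≤ w, ∀ r : ℕ, r / 2 = i →
      ∑ l ∈ Finset.range (w + 1), (lineEntries (oneBased A) n r l).length * 2 ^ l = 2 ^ K := by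
  obtain ⟨K, hK⟩ := (hA i).2
  refine ⟨K, ?_, fun r hr => ?_⟩
  · have := hw i
    rw [hK] at this
    exact (Nat.pow_le_pow_iff_right (by omega : 1 < 2)).1 (by exact_mod_cast this)
  have hs : ∑ j, max (lineSign r * A i j) 0 = 2 ^ K := by
    rw [← hK]
    rcases lineSign_eq r with h | h
    · simp [h]
    · simp only [h, neg_one_mul]
      exact sum_neg_part hA i
  have : ((∑ l ∈ Finset.range (w + 1), (lineEntries (oneBased A) n r l).length * 2 ^ l : ℕ) : ℤ) =
      2 ^ K := by
    rw [← hs, ← Finset.sum_congr rfl fun j _ => sum_bitAt (lineSign_eq r) (natAbs_lt hA hw i j),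
      ← Nat.cast_sum, Finset.sum_comm]
    congr 1
    refine Finset.sum_congr rfl fun l _ => ?_
    rw [lineEntries, bitEntries_eq, ← List.countP_eq_length_filter, countP_range'_one,
      Finset.sum_mul]
    refine Finset.sum_congr rfl fun j _ => ?_
    rw [hr, oneBased_succ]
    split_ifs <;> simp
  exact_mod_cast this

theorem lineEntries_eq_nil (hA : IsGz2 A) (hw : IsWBounded w A) {r l : ℕ} (hl : w < l) :
    lineEntries (oneBased A) n r l = [] := by
  refine List.eq_nil_iff_forall_not_mem.2 fun j hj => ?_
  have hb := (mem_lineEntries.1 hj).2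
  unfold oneBased at hb
  split_ifs at hb with h
  · rw [bitAt, Nat.testBit_lt_two_pow] at hb
    · simp at hb
    · exact (natAbs_lt hA hw _ _).trans_le (Nat.pow_le_pow_right (by omega) hl)
  · rw [bitAt_zero] at hb
    exact Bool.noConfusion hb

/-- If the entries of a line add up to `2 ^ K`, there is one entry left at the end, with digit
`K`. -/
theorem digitList_final (hA : IsGz2 A) (hw : IsWBounded w A) {r K : ℕ} (hK : K ≤ w)
    (h : ∑ l ∈ Finset.range (w + 1), (lineEntries (oneBased A) n r l).length * 2 ^ l = 2 ^ K) :
    (∀ l ≤ w, (levelEntries (oneBased A) n w r l).length = 1 ↔ l = K) ∧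
      ∀ l, digitList (oneBased A) n w r w l =
        if l = K then levelEntries (oneBased A) n w r K else [] := by
  obtain ⟨h1, h2, h3⟩ := carry_of_sum_eq_two_pow h
  have hev : ∀ l < K, Even (levelEntries (oneBased A) n w r l).length := fun l hl => by
    rw [length_levelEntries]; exact h1 l hl (by omega)
  have hone : (levelEntries (oneBased A) n w r K).length = 1 := by
    rw [length_levelEntries]; exact h2 (by omega)
  have hzero : ∀ l, K < l → l ≤ w → (levelEntries (oneBased A) n w r l).length = 0 :=
    fun l hl hlw => by
      rw [length_levelEntries]; exact h3 l hl (by omega)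
  refine ⟨fun l hl => ⟨fun h => ?_, fun h => h ▸ hone⟩, fun l => ?_⟩
  · rcases lt_trichotomy l K with hlt | he | hgt
    · obtain ⟨c, hc⟩ := hev l hlt
      omega
    · exact he
    · rw [hzero l hgt hl] at h
      omega
  · unfold digitList
    rw [← length_levelEntries_div (a := oneBased A) (n := n) (w := w)]
    rcases lt_trichotomy l K with hlt | rfl | hgt
    · rw [if_pos (by omega), if_neg hlt.ne, Nat.two_mul_div_two_of_even (hev l hlt),
        List.drop_length]
    · rw [if_pos rfl, hone]
      split_ifs with h4
      · rfl
      · rfl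
      · omega
    · rw [if_neg hgt.ne']
      split_ifs with h4 h5
      · rw [List.eq_nil_of_length_eq_zero (hzero l hgt (by omega)), List.drop_nil]
      · exact List.eq_nil_of_length_eq_zero (hzero l hgt (by omega))
      · exact lineEntries_eq_nil hA hw (by omega)

end Line

theorem length_lineEntries_le (a : ℕ → ℕ → ℤ) (n r k : ℕ) : (lineEntries a n r k).length ≤ n := by
  rw [lineEntries, bitEntries_eq]
  exact (List.length_filter_le _ _).trans (by simp)

theorem lineCarry_le (a : ℕ → ℕ → ℤ) (n r k : ℕ) : lineCarry a n r k ≤ n :=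
  carry_le (length_lineEntries_le a n r) k

theorem blockOff_le (a : ℕ → ℕ → ℤ) (n w b : ℕ) : blockOff a n w b ≤ b * n := by
  refine (Finset.sum_le_card_nsmul _ _ n fun c _ => lineCarry_le a n _ _).trans ?_
  simp

theorem exists_block {a : ℕ → ℕ → ℤ} {n w N ρ : ℕ} (h : ρ < blockOff a n w N) :
    ∃ b < N, blockOff a n w b ≤ ρ ∧ ρ < blockOff a n w (b + 1) := by
  induction N with
  | zero => simp [blockOff] at h
  | succ N ih =>
    rcases Nat.lt_or_ge ρ (blockOff a n w N) with h' | h'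
    · obtain ⟨b, hb, h1⟩ := ih h'
      exact ⟨b, by omega, h1⟩
    · exact ⟨N, by omega, h', h⟩

/-- The number of replaced pairs. -/
def numPairs (a : ℕ → ℕ → ℤ) (n m w : ℕ) : ℕ := blockOff a n w (2 * m * w)

theorem pair_bounds {a : ℕ → ℕ → ℤ} {n m w ρ : ℕ} (h : ρ < numPairs a n m w) :
    (1 ≤ pairFst a n m w ρ ∧ pairFst a n m w ρ ≤ n + numPairs a n m w) ∧
      1 ≤ pairSnd a n m w ρ ∧ pairSnd a n m w ρ ≤ n + numPairs a n m w := by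
  obtain ⟨b, hb, h1, h2⟩ := exists_block h
  have hpb := pairBlock_eq hb h1 h2
  have hw : 0 < w := Nat.pos_of_ne_zero fun h0 => by simp [h0] at hb
  have hmono := blockOff_mono (a := a) (n := n) (w := w) hb.le
  have hlen := length_levelEntries_div (a := a) (n := n) (w := w) (b / w) (b % w)
  rw [← blockLen] at hlen
  rw [blockOff_succ] at h2
  have hentry : ∀ v < (levelEntries a n w (b / w) (b % w)).length,
      1 ≤ blockEntry a n w b v ∧ blockEntry a n w b v ≤ n + numPairs a n m w := by
    intro v hv
    have hmem : blockEntry a n w b v ∈ levelEntries a n w (b / w) (b % w) := by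
      rw [blockEntry, List.getD_eq_getElem _ _ hv]
      exact List.getElem_mem hv
    have := levelEntries_bounds hmem (Nat.mod_lt _ hw).le
    rw [Nat.div_add_mod' b w] at this
    rw [numPairs]
    omega
  rw [pairFst, pairSnd, hpb]
  exact ⟨hentry _ (by omega), hentry _ (by omega)⟩

theorem getD_flatMap {α : Type} {f : ℕ → List α} {c N i : ℕ} (hf : ∀ k, (f k).length = c)
    (hi : i < c * N) (d : α) :
    ((List.range N).flatMap f).getD i d = (f (i / c)).getD (i % c) d := by
  have hc : 0 < c := Nat.pos_of_ne_zero fun h => by simp [h] at hi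
  induction N with
  | zero => simp at hi
  | succ N ih =>
    have hlen : ((List.range N).flatMap f).length = c * N := by
      simp [List.length_flatMap, hf, Nat.mul_comm]
    rw [List.range_succ, List.flatMap_append, List.flatMap_singleton]
    rcases Nat.lt_or_ge i (c * N) with h | h
    · rw [List.getD_append _ _ _ _ (by omega), ih h]
    · rw [List.getD_append_right _ _ _ _ (by omega), hlen]
      obtain ⟨j, rfl⟩ := Nat.exists_eq_add_of_le h
      rw [Nat.mul_succ] at hi
      rw [Nat.mul_add_div hc, Nat.mul_add_mod, Nat.div_eq_of_lt (by omega),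
        Nat.mod_eq_of_lt (by omega), Nat.add_zero, Nat.add_sub_cancel_left]

section Output

variable {m n : ℕ} (w : ℕ) (A : Matrix (Fin m) (Fin n) ℤ)

theorem prRows_eq : prRows w A = m + 8 * numPairs (oneBased A) n m w := (prRun_inv w A 0).rows

theorem prNumX_eq : prNumX w A = n + 5 * numPairs (oneBased A) n m w := by
  rw [prNumX, (prRun_inv w A 0).cols, (prRun_inv w A 0).ng, numPairs]
  ring

theorem prCols_eq : prCols w A = 2 * (n + 5 * numPairs (oneBased A) n m w) := by
  rw [prCols, prNumX_eq]

/-- The variable of the column with index `q`, when there are `N` variables of each kind. -/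
def colVar (N q : ℕ) : MCVar := if q < N then .x (q + 1) else .y (q - N + 1)

variable {w A}

/-- The signed binary digits of the transformed rows. -/
theorem bitAt_final (hA : IsGz2 A) (hw : IsWBounded w A) (ng₀ : ℕ) (i : Fin m) :
    ∃ K ≤ w, ∀ r : ℕ, r / 2 = i →
      (∀ l ≤ w, (levelEntries (oneBased A) n w r l).length = 1 ↔ l = K) ∧
      (∃ p, levelEntries (oneBased A) n w r K = [p] ∧ 1 ≤ p ∧
        p ≤ n + numPairs (oneBased A) n m w) ∧
      ∀ j l, bitAt ((prRun w A ng₀).A (i + 1) j) (lineSign r) l =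
        decide (l = K ∧ j ∈ levelEntries (oneBased A) n w r K) := by
  obtain ⟨K, hK, hsum⟩ := exists_line_sum hA hw i
  refine ⟨K, hK, fun r hr => ?_⟩
  obtain ⟨h1, h2⟩ := digitList_final hA hw hK (hsum r hr)
  have hrm : r < 2 * m := by have := i.2; omega
  have hbound : r * w + K ≤ 2 * m * w := by
    calc r * w + K ≤ (r + 1) * w := by rw [Nat.succ_mul]; omega
      _ ≤ 2 * m * w := Nat.mul_le_mul_right _ hrm
  refine ⟨h1, ?_, fun j l => ?_⟩
  · obtain ⟨p, hp⟩ := List.length_eq_one_iff.1 ((h1 K hK).2 rfl)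
    have hb := levelEntries_bounds (a := oneBased A) (n := n) (w := w) (r := r) (k := K) (j := p)
      (by simp [hp]) hK
    have := blockOff_mono (a := oneBased A) (n := n) (w := w) hbound
    exact ⟨p, hp, hb.1, by rw [numPairs]; omega⟩
  · have := (prRun_inv w A ng₀).bits r hrm j l
    have hle := Nat.mul_le_mul_right w (Nat.succ_le_of_lt hrm)
    rw [Nat.succ_mul] at hle
    rw [hr, min_eq_right (by omega), h2] at this
    rw [this, decide_eq_decide]
    split_ifs with h <;> simp [h]

theorem prMatrix_top (r : Fin (prRows w A)) (q : Fin (prCols w A)) (hr : r.1 < m) :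
    prMatrix w A r q = if q.1 < n + 5 * numPairs (oneBased A) n m w then
      (prRun w A (prRun w A 0).cols).A (r + 1) (q + 1) else 0 := by
  unfold prMatrix
  simp only [if_pos hr, prNumX_eq]
  split_ifs <;> rfl

theorem prMatrix_bot (r : Fin (prRows w A)) (q : Fin (prCols w A)) (hr : m ≤ r.1) :
    prMatrix w A r q = (pairGadget (oneBased A) n m w (n + numPairs (oneBased A) n m w)
      ((r - m) / 8)).getD ((r - m) % 8) 0 (colVar (n + 5 * numPairs (oneBased A) n m w) q) := by
  have h2 := r.2.trans_eq (prRows_eq w A)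
  unfold prMatrix
  simp only [if_neg (not_lt.2 hr), prNumX_eq]
  rw [(prRun_inv w A _).C, getD_flatMap (c := 8) (fun _ => rfl)
    (by rw [numPairs] at h2; omega), (prRun_inv w A 0).cols]
  rfl

theorem single_x_colVar {N i q : ℕ} (hi : 1 ≤ i) (hiN : i ≤ N) :
    (Pi.single (MCVar.x i) 1 : MCVar → ℤ) (colVar N q) = if q = i - 1 then 1 else 0 := by
  unfold colVar
  rw [Pi.single_apply]
  split_ifs with h1 h2 h3 h3 h3 h3 <;> simp at * <;> omega

theorem single_y_colVar {N i q : ℕ} (hi : 1 ≤ i) :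
    (Pi.single (MCVar.y i) 1 : MCVar → ℤ) (colVar N q) = if q = N + (i - 1) then 1 else 0 := by
  unfold colVar
  rw [Pi.single_apply]
  split_ifs with h1 h2 h3 h3 h3 h3 <;> simp at * <;> omega

/-- The row `f` is a nonzero multiple of one of the three kinds of rows of a two-commodity matrix
with `N` variables of each kind. -/
def IsMC2Row {p : ℕ} (N : ℕ) (f : Fin p → ℤ) : Prop :=
  ∃ c : ℤ, c ≠ 0 ∧ ∃ i < N, ∃ j < N, i ≠ j ∧
    let x : ℕ → ℕ → ℤ := fun i l => if l = i then 1 else 0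
    let y : ℕ → ℕ → ℤ := fun i l => if l = N + i then 1 else 0
    ((∀ l : Fin p, f l = c * (x i l - x j l)) ∨
     (∀ l : Fin p, f l = c * (y i l - y j l)) ∨
     (∀ l : Fin p, f l = c * (x i l - y i l - (x j l - y j l))))

theorem isMC2Row_gadget {p N t t' j₁ j₂ e : ℕ} (h₁ : 1 ≤ j₁) (h₂ : 1 ≤ j₂) (h₁' : j₁ ≤ t')
    (h₂' : j₂ ≤ t') (ht : 1 ≤ t) (htt : t ≤ t') (hN : t' + 4 ≤ N) (he : e < 8) :
    IsMC2Row N fun q : Fin p => (mcGadget t t' j₁ j₂).getD e 0 (colVar N q) := by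
  have hx : ∀ i j, 1 ≤ i → i ≤ N → 1 ≤ j → j ≤ N → i ≠ j → IsMC2Row N fun q : Fin p =>
      (Pi.single (MCVar.x i) 1 - Pi.single (MCVar.x j) 1 : MCVar → ℤ) (colVar N q) := by
    intro i j hi hi' hj hj' hij
    refine ⟨1, one_ne_zero, i - 1, by omega, j - 1, by omega, by omega, .inl fun q => ?_⟩
    simp only [Pi.sub_apply, single_x_colVar hi hi', single_x_colVar hj hj', one_mul]
  have hy : ∀ i j, 1 ≤ i → i ≤ N → 1 ≤ j → j ≤ N → i ≠ j → IsMC2Row N fun q : Fin p =>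
      (Pi.single (MCVar.y i) 1 - Pi.single (MCVar.y j) 1 : MCVar → ℤ) (colVar N q) := by
    intro i j hi hi' hj hj' hij
    refine ⟨1, one_ne_zero, i - 1, by omega, j - 1, by omega, by omega, .inr (.inl fun q => ?_)⟩
    simp only [Pi.sub_apply, single_y_colVar hi, single_y_colVar hj, one_mul]
  have hxy : ∀ i j, 1 ≤ i → i ≤ N → 1 ≤ j → j ≤ N → i ≠ j → IsMC2Row N fun q : Fin p =>
      (Pi.single (MCVar.x i) 1 - Pi.single (MCVar.y i) 1 -
        (Pi.single (MCVar.x j) 1 - Pi.single (MCVar.y j) 1) : MCVar → ℤ) (colVar N q) := by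
    intro i j hi hi' hj hj' hij
    refine ⟨1, one_ne_zero, i - 1, by omega, j - 1, by omega, by omega, .inr (.inr fun q => ?_)⟩
    simp only [Pi.sub_apply, single_x_colVar hi hi', single_x_colVar hj hj', single_y_colVar hi,
      single_y_colVar hj, one_mul]
  interval_cases e
  · exact hx _ _ (by omega) (by omega) (by omega) (by omega) (by omega)
  · exact hx _ _ (by omega) (by omega) (by omega) (by omega) (by omega)
  · exact hy _ _ (by omega) (by omega) (by omega) (by omega) (by omega)
  · exact hy _ _ (by omega) (by omega) (by omega) (by omega) (by omega)
  · exact hx _ _ (by omega) (by omega) (by omega) (by omega) (by omega)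
  · exact hx _ _ (by omega) (by omega) (by omega) (by omega) (by omega)
  · exact hxy _ _ (by omega) (by omega) (by omega) (by omega) (by omega)
  · exact hxy _ _ (by omega) (by omega) (by omega) (by omega) (by omega)

theorem prMatrix_isMC2 (hA : IsGz2 A) (hw : IsWBounded w A) : IsMC2 (prMatrix w A) := by
  refine ⟨n + 5 * numPairs (oneBased A) n m w, prCols_eq w A, fun r => ?_⟩
  have hr2 := r.2.trans_eq (prRows_eq w A)
  rcases Nat.lt_or_ge r.1 m with hr | hr
  · obtain ⟨K, hK, h⟩ := bitAt_final hA hw (prRun w A 0).cols ⟨r, hr⟩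
    obtain ⟨-, ⟨p, hp, hp1, hp2⟩, hpb⟩ := h (2 * r) (by simp)
    obtain ⟨-, ⟨p', hp', hp1', hp2'⟩, hpb'⟩ := h (2 * r + 1) (by simp; omega)
    have e1 : lineSign (2 * r) = 1 := by simp [lineSign]
    have e2 : lineSign (2 * r + 1) = -1 := by simp [lineSign]
    simp only [hp, hp', e1, e2, List.mem_singleton] at hpb hpb'
    have hne : p ≠ p' := by
      rintro rfl
      have h1 := hpb p K
      have h2 := hpb' p K
      simp [bitAt] at h1 h2
      omega
    refine ⟨2 ^ K, by positivity, p - 1, by omega, p' - 1, by omega, by omega, ?_⟩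
    refine .inl fun q => ?_
    rw [prMatrix_top r q hr]
    have hval : ∀ j, (prRun w A (prRun w A 0).cols).A (r + 1) j =
        2 ^ K * ((if j = p then 1 else 0) - if j = p' then 1 else 0) := by
      intro j
      refine eq_of_bitAt_eq fun s hs l => ?_
      have hR : bitAt (2 ^ K * ((if j = p then 1 else 0) - if j = p' then 1 else 0)) s l =
          decide (l = K ∧ ((s = 1 ∧ j = p) ∨ (s = -1 ∧ j = p'))) := by
        by_cases h1 : j = p
        · have := bitAt_two_pow (s' := s) (.inl rfl) K l
          rw [one_mul] at this
          subst h1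
          simp [hne, this, Bool.and_comm]
        · by_cases h2 : j = p'
          · have := bitAt_two_pow (s' := s) (.inr rfl) K l
            rw [neg_one_mul] at this
            subst h2
            simp [h1, this, Bool.and_comm]
          · simp [h1, h2, bitAt_zero]
      rw [hR]
      rcases hs with rfl | rfl
      · rw [hpb]; simp
      · rw [hpb']; simp
    split_ifs with hq
    · rw [hval]
      have e3 : (q.1 + 1 = p) = (q.1 = p - 1) := by rw [eq_iff_iff]; omega
      have e4 : (q.1 + 1 = p') = (q.1 = p' - 1) := by rw [eq_iff_iff]; omega
      simp only [e3, e4]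
    · beta_reduce
      rw [if_neg (by omega), if_neg (by omega)]
      simp
  · obtain ⟨ρ, e, he, hρe⟩ : ∃ ρ e, e < 8 ∧ r.1 - m = 8 * ρ + e :=
      ⟨(r.1 - m) / 8, (r.1 - m) % 8, by omega, by omega⟩
    have hρ : ρ < numPairs (oneBased A) n m w := by omega
    obtain ⟨⟨h1, h1'⟩, h2, h2'⟩ := pair_bounds hρ
    simp only [prMatrix_bot r _ hr, hρe, show (8 * ρ + e) / 8 = ρ by omega,
      show (8 * ρ + e) % 8 = e by omega]
    exact isMC2Row_gadget h1 h2 (by omega) (by omega) (by omega) (by omega) (by omega) he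

end Output

/-! ### The closed form is computed by threshold circuits

The depths are explicit numbers. Only their independence of `n`, `m`, `w` and of the indices matters;
they are not optimal. -/

theorem bitAt_signMag {p : ℕ} (b : Fin (p + 1) → Bool) {s : ℤ} (l : ℕ) :
    bitAt (signMag b) s l = (decide (s = if b 0 then -1 else 1) &&
      if h : l < p then b (Fin.succ ⟨l, h⟩) else false) := by
  rw [signMag, bitAt_mul (by split_ifs <;> simp), Nat.testBit_ofBits]

/-- The entries of the represented matrix, numbered from `1`. -/
def inputEntry {n m w : ℕ} (x : PRInput n m w → Bool) : ℕ → ℕ → ℤ := oneBased (inputMatrix x)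

/-- All numbers that have to be represented in unary are smaller than `V`. -/
structure SizeBound (n m w V : ℕ) : Prop where
  cols : n < V
  levels : w + 1 < V
  blocks : 2 * m * w < V
  pairs : n + 2 * m * w * n < V
  windowTerm : n * 2 ^ n.size < V
  window : w * (n * 2 ^ n.size) < V
  idx : 2 ^ idxBits n m w ≤ V

/-- Position `v` of the sublist of `1, …, n` given by `p` is found by counting. -/
theorem getD_filter_range'_one {p : ℕ → Bool} {n v : ℕ}
    (hv : v < ((List.range' 1 n).filter p).length) :
    ((List.range' 1 n).filter p).getD v 0 =
      1 + (List.range' 1 n).countP fun j => decide ((List.range' 1 j).countP p ≤ v) := by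
  induction n with
  | zero => simp at hv
  | succ n ih =>
    rw [List.range'_1_concat, List.filter_append] at hv ⊢
    rw [List.countP_append, List.countP_singleton]
    rcases Nat.lt_or_ge v ((List.range' 1 n).filter p).length with h | h
    · rw [List.getD_append _ _ _ _ h, ih h, Nat.add_comm 1 n, List.range'_1_concat,
        List.countP_append, if_neg]
      · rfl
      · rw [List.countP_eq_length_filter]
        simp
        omega
    · rw [List.getD_append_right _ _ _ _ h]
      have hp : p (1 + n) = true := by
        by_contra hp
        simp [hp] at hv
        omega
      have hv' : v = ((List.range' 1 n).filter p).length := by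
        simp [hp] at hv
        omega
      have hall : (List.range' 1 n).countP (fun j => decide ((List.range' 1 j).countP p ≤ v)) =
          (List.range' 1 n).length := by
        refine List.countP_eq_length.2 fun j hj => decide_eq_true ?_
        have hj' := List.mem_range'_1.1 hj
        rw [hv', ← List.countP_eq_length_filter]
        refine List.Sublist.countP_le ?_
        obtain ⟨d, hd⟩ := Nat.exists_eq_add_of_le (show j ≤ n by omega)
        rw [hd, ← List.range'_append_1]
        exact List.sublist_append_left _ _
      have hlast : ¬ (List.range' 1 (1 + n)).countP p ≤ v := by
        rw [Nat.add_comm 1 n, List.range'_1_concat, List.countP_append, List.countP_singleton,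
          if_pos hp, hv', ← List.countP_eq_length_filter]
        omega
      rw [hall, decide_eq_false hlast, hv']
      simp [hp]

theorem TCNat.ofBool {ι : Type} {F D : ℕ} {f : (ι → Bool) → Bool} (hf : TCComp F D f)
    (hF : 14 ≤ F) : TCNat F (D + 7) fun x => (f x).toNat :=
  (TCNat.countP (l := [()]) (p := fun _ => f) (fun _ _ => hf) (by simpa using hF)).congr
    fun x => by cases f x <;> simp_all

section Pieces

variable {n m w V : ℕ}

theorem tc_bitAt (i j r l : ℕ) : TCComp (ι := PRInput n m w) (4 * V + 10) 4 fun x =>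
    bitAt (inputEntry x i j) (lineSign r) l := by
  by_cases h : (1 ≤ i ∧ i ≤ m) ∧ (1 ≤ j ∧ j ≤ n)
  · by_cases hl : l < w + 1
    · have h1 := TCComp.input (F := 4 * V + 10) 0
        (Sum.inl (⟨i - 1, by omega⟩, ⟨j - 1, by omega⟩, Fin.succ ⟨l, hl⟩) : PRInput n m w)
      have h2 := TCComp.input (F := 4 * V + 10) 0
        (Sum.inl (⟨i - 1, by omega⟩, ⟨j - 1, by omega⟩, 0) : PRInput n m w)
      have key : ∀ x : PRInput n m w → Bool, bitAt (inputEntry x i j) (lineSign r) l =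
          (decide (lineSign r = if x (Sum.inl (⟨i - 1, by omega⟩, ⟨j - 1, by omega⟩, 0)) then -1
            else 1) && x (Sum.inl (⟨i - 1, by omega⟩, ⟨j - 1, by omega⟩, Fin.succ ⟨l, hl⟩))) := by
        intro x
        rw [inputEntry, oneBased, dif_pos h, inputMatrix, bitAt_signMag, dif_pos hl]
      rcases lineSign_eq r with hs | hs
      · exact (h2.not.and h1 (by omega)).congr fun x => by
          rw [key, hs]
          congr 1
          cases x _ <;> simp
      · exact ((h2.and h1 (by omega)).mono (by decide)).congr fun x => by
          rw [key, hs]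
          congr 1
          cases x _ <;> simp
    · refine (TCComp.const (D := 2) false).congr fun x => ?_
      rw [inputEntry, oneBased, dif_pos h, inputMatrix, bitAt_signMag, dif_neg hl, Bool.and_false]
  · refine (TCComp.const (D := 2) false).congr fun x => ?_
    rw [inputEntry, oneBased, dif_neg h, bitAt_zero]

theorem tc_lineEntries (hV : SizeBound n m w V) (r l : ℕ) :
    TCNat (ι := PRInput n m w) (4 * V + 10) 11 fun x =>
      (lineEntries (inputEntry x) n r l).length := by
  refine (TCNat.countP (l := List.range' 1 n)
    (p := fun j x => bitAt (inputEntry x (r / 2 + 1) j) (lineSign r) l)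
    (fun j _ => tc_bitAt _ j r l) ?_).congr fun x => ?_
  · have := hV.cols
    rw [List.length_range']
    omega
  · rw [lineEntries, bitEntries_eq, List.countP_eq_length_filter]

/-- The quotient that determines the carry into position `k` up to one unit. -/
def carryQuot (a : ℕ → ℕ → ℤ) (n r k : ℕ) : ℕ :=
  carryWindow (fun l => (lineEntries a n r l).length) n.size k / 2 ^ n.size

theorem carryWindow_term_le (a : ℕ → ℕ → ℤ) (n r k l : ℕ) (hlk : l < k) :
    ((lineEntries a n r l).length * if k ≤ l + n.size then 2 ^ (l + n.size - k) else 0) ≤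
      n * 2 ^ n.size := by
  refine Nat.mul_le_mul (length_lineEntries_le _ _ _ _) ?_
  split_ifs
  · exact Nat.pow_le_pow_right (by omega) (by omega)
  · exact Nat.zero_le _

theorem carryQuot_bounds (a : ℕ → ℕ → ℤ) (n r k : ℕ) :
    carryQuot a n r k ≤ lineCarry a n r k ∧ lineCarry a n r k ≤ carryQuot a n r k + 1 :=
  carryWindow_bounds (length_lineEntries_le a n r) (Nat.lt_size_self n) k

theorem tc_carryQuot (hV : SizeBound n m w V) (r : ℕ) {k : ℕ} (hk : k ≤ w) :
    TCNat (ι := PRInput n m w) (4 * V + 10) 36 fun x => carryQuot (inputEntry x) n r k := by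
  have h1 : TCNat (ι := PRInput n m w) (4 * V + 10) 30 fun x =>
      carryWindow (fun l => (lineEntries (inputEntry x) n r l).length) n.size k := by
    refine (TCNat.sum (D := 17) (M := n * 2 ^ n.size) (φ := fun l x =>
      (lineEntries (inputEntry x) n r l).length *
        if k ≤ l + n.size then 2 ^ (l + n.size - k) else 0) (fun l _ => ?_) (fun l hl x => ?_)
      ?_ ?_).mono (by decide)
    · exact (tc_lineEntries hV r l).comp
        (fun x => (length_lineEntries_le _ _ _ _).trans_lt hV.cols) (by omega) fun v =>
          v * if k ≤ l + n.size then 2 ^ (l + n.size - k) else 0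
    · exact carryWindow_term_le _ _ _ _ _ hl
    · have := hV.window
      have := Nat.mul_le_mul_right (n * 2 ^ n.size) hk
      omega
    · have := hV.windowTerm
      omega
  refine h1.comp (V := V) (fun x => ?_) (by omega) fun v => v / 2 ^ n.size
  refine lt_of_le_of_lt ?_ hV.window
  refine (Finset.sum_le_card_nsmul _ _ (n * 2 ^ n.size) fun l hl => ?_).trans ?_
  · exact carryWindow_term_le _ _ _ _ _ (Finset.mem_range.1 hl)
  · rw [Finset.card_range, smul_eq_mul]
    exact Nat.mul_le_mul_right _ hk

/-- The carry is the quotient of its window plus one unit, which is found by carry look-ahead. -/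
theorem tc_lineCarry (hV : SizeBound n m w V) (r : ℕ) {k : ℕ} (hk : k ≤ w) :
    TCNat (ι := PRInput n m w) (4 * V + 10) 100 fun x => lineCarry (inputEntry x) n r k := by
  have hcols := hV.cols
  have hqV : ∀ k (x : PRInput n m w → Bool), carryQuot (inputEntry x) n r k < V := fun k x =>
    ((carryQuot_bounds _ _ _ _).1.trans (lineCarry_le _ _ _ _)).trans_lt hV.cols
  have hoV : ∀ l (x : PRInput n m w → Bool), (lineEntries (inputEntry x) n r l).length < V :=
    fun l x => (length_lineEntries_le _ _ _ _).trans_lt hV.cols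
  have hgen : ∀ c i, i < k → TCComp (ι := PRInput n m w) (4 * V + 10) 60 fun x =>
      decide (carryQuot (inputEntry x) n r (i + 1) <
        ((lineEntries (inputEntry x) n r i).length + carryQuot (inputEntry x) n r i + c) / 2) := by
    intro c i hi
    refine (TCNat.bindBool (V := V) (tc_lineEntries hV r i) (hoV i)
      (ψ := fun v x => decide (carryQuot (inputEntry x) n r (i + 1) <
        (v + carryQuot (inputEntry x) n r i + c) / 2)) (D' := 48) (fun v _ => ?_)
      (by omega)).mono (by decide)
    exact (tc_carryQuot hV r (by omega)).testBool₂ (hqV _)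
      (tc_carryQuot hV r (by omega)) (hqV _) (by omega) (by omega)
      fun u u' => decide (u < (v + u' + c) / 2)
  have hlook : TCComp (ι := PRInput n m w) (4 * V + 10) 72 fun x =>
      decide (carryQuot (inputEntry x) n r k < lineCarry (inputEntry x) n r k) := by
    have hkF : 4 * (List.range k).length + 2 ≤ 4 * V + 10 := by
      have := hV.levels
      rw [List.length_range]
      omega
    refine ((TCComp.any (l := List.range k) (fun i hi => ?_) hkF).congr fun x =>
      (carry_lookahead (by simp [carryQuot, carryWindow])
        (carryQuot_bounds (inputEntry x) n r) k).symm).mono (D := 72) (by decide)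
    refine ((hgen 0 i (List.mem_range.1 hi)).and (TCComp.all (l := List.range k) (D := 63)
      (fun l hl => ?_) hkF) (by omega)).mono (by decide)
    exact (TCComp.or (.const (D := 0) _) (hgen 1 l (List.mem_range.1 hl)) (by omega)).mono
      (by decide)
  refine (((tc_carryQuot hV r hk).comp₂ (hqV k) (TCNat.ofBool hlook (by omega)) (V' := V)
    (fun x => ?_) (by omega) (by omega) fun u v => u + v).mono (by decide)).congr fun x => ?_
  · have := Bool.toNat_lt (decide (carryQuot (inputEntry x) n r k < lineCarry (inputEntry x) n r k))
    have := hV.levels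
    omega
  · have := carryQuot_bounds (inputEntry x) n r k
    by_cases h : carryQuot (inputEntry x) n r k < lineCarry (inputEntry x) n r k
    · rw [decide_eq_true h, Bool.toNat_true]
      omega
    · rw [decide_eq_false h, Bool.toNat_false]
      omega

theorem blockOff_lt (hV : SizeBound n m w V) {b : ℕ} (hb : b ≤ 2 * m * w) (a : ℕ → ℕ → ℤ) :
    blockOff a n w b < V :=
  (((blockOff_le a n w b).trans (Nat.mul_le_mul_right n hb)).trans (Nat.le_add_left _ n)).trans_lt
    hV.pairs

theorem tc_blockOff (hV : SizeBound n m w V) (hw : 0 < w) {b : ℕ} (hb : b ≤ 2 * m * w) :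
    TCNat (ι := PRInput n m w) (4 * V + 10) 113 fun x => blockOff (inputEntry x) n w b := by
  refine TCNat.sum (D := 100) (M := n) (φ := fun c x => blockLen (inputEntry x) n w c)
    (fun c _ => tc_lineCarry hV _ (Nat.mod_lt c hw)) (fun c _ x => lineCarry_le _ _ _ _) ?_ ?_
  · have := hV.pairs
    have := Nat.mul_le_mul_right n hb
    omega
  · have := hV.cols
    omega

theorem tc_levelEntries (hV : SizeBound n m w V) (hw : 0 < w) {r k : ℕ} (hk : k ≤ w)
    (hrk : r * w + k ≤ 2 * m * w + 1)
    (v : ℕ) : TCNat (ι := PRInput n m w) (4 * V + 10) 160 fun x =>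
      (levelEntries (inputEntry x) n w r k).getD v 0 := by
  have hcols := hV.cols
  have hoV : ∀ l (x : PRInput n m w → Bool), (lineEntries (inputEntry x) n r l).length < V :=
    fun l x => (length_lineEntries_le _ _ _ _).trans_lt hV.cols
  have hcnt : ∀ j ≤ n, TCNat (ι := PRInput n m w) (4 * V + 10) 11 fun x =>
      (List.range' 1 j).countP fun j => bitAt (inputEntry x (r / 2 + 1) j) (lineSign r) k :=
    fun j hj => TCNat.countP (p := fun j x => bitAt (inputEntry x (r / 2 + 1) j) (lineSign r) k)
      (fun j _ => tc_bitAt _ j r k) (by rw [List.length_range']; omega)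
  have hnth : TCNat (ι := PRInput n m w) (4 * V + 10) 24 fun x =>
      (List.range' 1 n).countP fun j => decide ((List.range' 1 j).countP
        (fun j => bitAt (inputEntry x (r / 2 + 1) j) (lineSign r) k) ≤ v) := by
    refine TCNat.countP (D := 17) (p := fun j x => decide ((List.range' 1 j).countP
        (fun j => bitAt (inputEntry x (r / 2 + 1) j) (lineSign r) k) ≤ v)) (fun j hj => ?_)
      (by rw [List.length_range']; omega)
    have hj' := List.mem_range'_1.1 hj
    exact (hcnt j (by omega)).testBool (V := V) (fun x => List.countP_le_length.trans_lt
      (by rw [List.length_range']; omega)) (by omega) fun u => decide (u ≤ v)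
  refine ((TCNat.bind (V := V) (tc_lineEntries hV r k) (hoV k) (D' := 140)
    (ψ := fun o x => if v < o then 1 + (List.range' 1 n).countP fun j => decide
      ((List.range' 1 j).countP (fun j => bitAt (inputEntry x (r / 2 + 1) j) (lineSign r) k) ≤ v)
      else if v - o < lineCarry (inputEntry x) n r k then
        n + blockOff (inputEntry x) n w (r * w + k - 1) + 1 + (v - o) else 0)
    (fun o _ => ?_) (by omega)).mono (by decide)).congr fun x => ?_
  · by_cases hvo : v < o
    · simp only [if_pos hvo]
      exact (hnth.comp (V := V) (fun x => List.countP_le_length.trans_lt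
        (by rw [List.length_range']; omega)) (by omega) fun u => 1 + u).mono (by decide)
    · simp only [if_neg hvo]
      exact ((tc_lineCarry hV r hk).comp₂ (V := V)
        (fun x => (lineCarry_le _ _ _ _).trans_lt hV.cols)
        (tc_blockOff hV hw (b := r * w + k - 1) (by omega)) (V' := V)
        (fun x => blockOff_lt hV (by omega) _) (by omega) (by omega)
        fun c u => if v - o < c then n + u + 1 + (v - o) else 0).mono (by decide)
  · unfold levelEntries
    split_ifs with h1 h2
    · rw [List.getD_append _ _ _ _ h1, lineEntries, bitEntries_eq, getD_filter_range'_one]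
      rwa [lineEntries, bitEntries_eq] at h1
    · rw [List.getD_append_right _ _ _ _ (by omega), List.getD_eq_getElem _ _ (by simpa using h2),
        List.getElem_range']
      omega
    · rw [List.getD_append_right _ _ _ _ (by omega), List.getD_eq_default _ _ (by simpa using h2)]

theorem tc_pairBlock (hV : SizeBound n m w V) (hw : 0 < w) (ρ : ℕ) :
    TCNat (ι := PRInput n m w) (4 * V + 10) 126 fun x => pairBlock (inputEntry x) n m w ρ := by
  have := hV.blocks
  refine TCNat.countP (D := 119) (p := fun b x => decide (blockOff (inputEntry x) n w (b + 1) ≤ ρ))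
    (fun b hb => ?_) (by rw [List.length_range]; omega)
  have hb := List.mem_range.1 hb
  exact (tc_blockOff hV hw (by omega)).testBool (V := V) (fun x => blockOff_lt hV (by omega) _)
    (by omega) fun u => decide (u ≤ ρ)

/-- The columns of a pair: its block and its position in the block are substituted into the list of
columns of a block. -/
theorem tc_pair (hV : SizeBound n m w V) (hw : 0 < w) (ρ c : ℕ) :
    TCNat (ι := PRInput n m w) (4 * V + 10) 200 fun x =>
      blockEntry (inputEntry x) n w (pairBlock (inputEntry x) n m w ρ)
        (2 * (ρ - blockOff (inputEntry x) n w (pairBlock (inputEntry x) n m w ρ)) + c) := by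
  have hblocks := hV.blocks
  refine (TCNat.bind (V := 2 * m * w + 1) (tc_pairBlock hV hw ρ) (D' := 180)
    (ψ := fun b x => blockEntry (inputEntry x) n w b
      (2 * (ρ - blockOff (inputEntry x) n w b) + c)) (fun x => ?_) (fun b hb => ?_)
    (by omega)).mono (by decide)
  · exact Nat.lt_succ_of_le (List.countP_le_length.trans (by rw [List.length_range]))
  · refine (TCNat.bind (V := V) (tc_blockOff hV hw (b := b) (by omega))
      (fun x => blockOff_lt hV (by omega) _)
      (ψ := fun u x => blockEntry (inputEntry x) n w b (2 * (ρ - u) + c)) (D' := 160)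
      (fun u _ => ?_) (by omega)).mono (by decide)
    exact tc_levelEntries hV hw (Nat.mod_lt b hw).le (by rw [Nat.div_add_mod']; omega) _

theorem tc_ofBits {p : ℕ} (e : Fin p → PRInput n m w) (hp : p ≤ V) :
    TCNat (4 * V + 10) 8 fun x : PRInput n m w → Bool => Nat.ofBits fun b => x (e b) := by
  intro v
  by_cases hv : v < 2 ^ p
  · refine ((TCComp.all (l := List.finRange p) (p := fun b x => x (e b) == v.testBit b) (D := 3)
      (fun b _ => ?_) (by rw [List.length_finRange]; omega)).mono (by decide)).congr fun x => ?_
    · cases h : v.testBit b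
      · exact ((TCComp.input 2 (e b)).not).congr fun x => by simp
      · exact (TCComp.input 3 (e b)).congr fun x => by simp
    · rw [Bool.eq_iff_iff, List.all_eq_true, decide_eq_true_iff]
      constructor
      · intro h
        refine Nat.eq_of_testBit_eq fun l => ?_
        rw [Nat.testBit_ofBits]
        split_ifs with hl
        · simpa using h ⟨l, hl⟩ (List.mem_finRange _)
        · exact (Nat.testBit_lt_two_pow (hv.trans_le
            (Nat.pow_le_pow_right (by omega) (by omega)))).symm
      · rintro rfl b _
        rw [Nat.testBit_ofBits, dif_pos b.2]
        simp
  · refine (TCComp.const (D := 6) false).congr fun x => ?_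
    have := Nat.ofBits_lt_two_pow fun b => x (e b)
    exact (decide_eq_false (this.trans_le (not_lt.1 hv)).ne).symm

end Pieces

/-! ### The output bits -/

section OutputBits

variable {n m w V : ℕ}

/-- Line `r` ends with a single entry, which has digit `l` and is in column `C`. -/
def isFinalEntry (x : PRInput n m w → Bool) (r l C : ℕ) : Bool :=
  decide ((levelEntries (inputEntry x) n w r l).length = 1) &&
    decide ((levelEntries (inputEntry x) n w r l).getD 0 0 = C)

/-- Bit `b` of an entry of a transformed row; bit `0` is the sign. -/
def rowBit (R C : ℕ) (b : Fin (w + 2)) (x : PRInput n m w → Bool) : Bool :=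
  if b = 0 then (List.range (w + 1)).any fun l => isFinalEntry x (2 * (R - 1) + 1) l C
  else isFinalEntry x (2 * (R - 1)) (b - 1) C || isFinalEntry x (2 * (R - 1) + 1) (b - 1) C

/-- Bit `b` of the representation of `v ∈ {-1, 0, 1}`; bit `0` is the sign. -/
def smallBit (v : ℤ) (b : ℕ) : Bool :=
  if b = 0 then decide (v < 0) else decide (b = 1) && decide (v ≠ 0)

/-- Bit `b` of the entry in row `R` and column `C` of the output matrix, and `0` outside of it. -/
def outBit (R C : ℕ) (b : Fin (w + 2)) (x : PRInput n m w → Bool) : Bool :=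
  if 1 ≤ R ∧ R ≤ m then rowBit R C b x
  else if m < R ∧ R ≤ m + 8 * numPairs (inputEntry x) n m w ∧ 1 ≤ C ∧
      C ≤ 2 * (n + 5 * numPairs (inputEntry x) n m w) then
    smallBit ((pairGadget (inputEntry x) n m w (n + numPairs (inputEntry x) n m w)
      ((R - 1 - m) / 8)).getD ((R - 1 - m) % 8) 0
        (colVar (n + 5 * numPairs (inputEntry x) n m w) (C - 1))) b
  else false

theorem tc_isFinalEntry (hV : SizeBound n m w V) {r l : ℕ} (hr : r < 2 * m) (hl : l ≤ w) (C : ℕ)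
    (hw : 0 < w) : TCComp (ι := PRInput n m w) (4 * V + 10) 163 fun x => isFinalEntry x r l C := by
  have hcols := hV.cols
  have hrw := Nat.mul_le_mul_right w (Nat.succ_le_of_lt hr)
  rw [Nat.succ_mul] at hrw
  refine (TCComp.and (D := 112) (D' := 160) ?_ (tc_levelEntries hV hw hl (by omega) 0 C)
    (by omega)).mono (by decide)
  refine (((tc_lineEntries hV r l).testBool₂ (V := V)
    (fun x => (length_lineEntries_le _ _ _ _).trans_lt hV.cols) (tc_lineCarry hV r hl) (V' := V)
    (fun x => (lineCarry_le _ _ _ _).trans_lt hV.cols) (by omega) (by omega)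
    fun u v => decide (u + v = 1)).mono (by decide)).congr fun x => ?_
  rw [length_levelEntries]

theorem tc_rowBit (hV : SizeBound n m w V) (hw : 0 < w) {R : ℕ} (hR : 1 ≤ R) (hRm : R ≤ m) (C : ℕ)
    (b : Fin (w + 2)) : TCComp (4 * V + 10) 166 (rowBit (n := n) (m := m) R C b) := by
  unfold rowBit
  split_ifs
  · refine TCComp.any (D := 163) (p := fun l x => isFinalEntry x (2 * (R - 1) + 1) l C)
      (fun l hl => ?_) ?_
    · exact tc_isFinalEntry hV (by omega) (by have := List.mem_range.1 hl; omega) C hw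
    · have := hV.levels
      rw [List.length_range]
      omega
  · exact (tc_isFinalEntry hV (by omega) (by omega) C hw).or
      (tc_isFinalEntry hV (by omega) (by omega) C hw) (by omega)

theorem blockEntry_lt (hV : SizeBound n m w V) (hw : 0 < w) {b : ℕ} (hb : b ≤ 2 * m * w)
    (a : ℕ → ℕ → ℤ) (v : ℕ) : blockEntry a n w b v < V := by
  rw [blockEntry]
  rcases Nat.lt_or_ge v (levelEntries a n w (b / w) (b % w)).length with h | h
  · rw [List.getD_eq_getElem _ _ h]
    have h1 := (levelEntries_bounds (List.getElem_mem h) (Nat.mod_lt b hw).le).2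
    rw [Nat.div_add_mod'] at h1
    have h2 := (blockOff_le a n w b).trans (Nat.mul_le_mul_right n hb)
    have := hV.pairs
    omega
  · rw [List.getD_eq_default _ _ h]
    exact Nat.zero_lt_of_lt hV.cols

theorem pairBlock_le (a : ℕ → ℕ → ℤ) (ρ : ℕ) : pairBlock a n m w ρ ≤ 2 * m * w :=
  List.countP_le_length.trans (by rw [List.length_range])

theorem tc_outBit (hV : SizeBound n m w V) (hw : 0 < w) (R C : ℕ) (b : Fin (w + 2)) :
    TCComp (4 * V + 10) 250 (outBit (n := n) (m := m) R C b) := by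
  unfold outBit
  by_cases hR : 1 ≤ R ∧ R ≤ m
  · simp only [if_pos hR]
    exact (tc_rowBit hV hw hR.1 hR.2 C b).mono (by decide)
  · simp only [if_neg hR]
    refine (TCNat.bindBool (tc_blockOff hV hw le_rfl) (fun x => blockOff_lt hV le_rfl _)
      (ψ := fun G x => if m < R ∧ R ≤ m + 8 * G ∧ 1 ≤ C ∧ C ≤ 2 * (n + 5 * G) then
        smallBit ((mcGadget (n + (R - 1 - m) / 8 + 1) (n + G + 4 * ((R - 1 - m) / 8))
          (pairFst (inputEntry x) n m w ((R - 1 - m) / 8))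
          (pairSnd (inputEntry x) n m w ((R - 1 - m) / 8))).getD ((R - 1 - m) % 8) 0
          (colVar (n + 5 * G) (C - 1))) b else false) (D' := 212)
      (fun G _ => ?_) (by omega)).mono (by decide)
    by_cases hG : m < R ∧ R ≤ m + 8 * G ∧ 1 ≤ C ∧ C ≤ 2 * (n + 5 * G)
    · simp only [if_pos hG]
      exact (tc_pair hV hw ((R - 1 - m) / 8) 0).testBool₂
        (fun x => blockEntry_lt hV hw (pairBlock_le _ _) _ _)
        (tc_pair hV hw ((R - 1 - m) / 8) 1)
        (fun x => blockEntry_lt hV hw (pairBlock_le _ _) _ _) (by omega) (by omega)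
        fun j₁ j₂ => smallBit ((mcGadget (n + (R - 1 - m) / 8 + 1)
          (n + G + 4 * ((R - 1 - m) / 8)) j₁ j₂).getD ((R - 1 - m) % 8) 0
          (colVar (n + 5 * G) (C - 1))) b
    · simp only [if_neg hG]
      exact (TCComp.const (D := 0) _).mono (by decide)

/-- Substituting the represented indices gives functions of constant depth. -/
theorem tc_output (hV : SizeBound n m w V) (hw : 0 < w) (b : Fin (w + 2)) :
    TCComp (4 * V + 10) 262 fun x : PRInput n m w → Bool =>
      outBit (inputRow x) (inputCol x) b x := by
  have hidx := hV.idx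
  have hp : idxBits n m w ≤ V := Nat.lt_two_pow_self.le.trans hidx
  refine (TCNat.bindBool (V := V) (tc_ofBits (fun b => .inr (.inl b)) hp)
    (fun x => (Nat.ofBits_lt_two_pow _).trans_le hidx)
    (ψ := fun R x => outBit R (inputCol x) b x) (D' := 256) (fun R _ => ?_) (by omega)).mono
    (by decide)
  exact (TCNat.bindBool (V := V) (tc_ofBits (fun b => .inr (.inr b)) hp)
    (fun x => (Nat.ofBits_lt_two_pow _).trans_le hidx) (ψ := fun C x => outBit R C b x) (D' := 250)
    (fun C _ => tc_outBit hV hw R C b) (by omega)).mono (by decide)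

theorem signMag_zero {p : ℕ} {b : Fin (p + 1) → Bool} (h : ∀ k, b k = false) : signMag b = 0 := by
  refine eq_of_bitAt_eq fun s _ l => ?_
  rw [bitAt_signMag, bitAt_zero]
  simp [h]

theorem signMag_smallBit {p : ℕ} {v : ℤ} (hv : -1 ≤ v) (hv' : v ≤ 1) :
    signMag (fun b : Fin (p + 2) => smallBit v b) = v := by
  refine eq_of_bitAt_eq fun s hs l => ?_
  rw [bitAt_signMag]
  obtain rfl | rfl | rfl : v = -1 ∨ v = 0 ∨ v = 1 := by omega
  · have := bitAt_two_pow (s' := s) (.inr rfl) 0 l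
    rw [pow_zero, mul_one] at this
    rw [this]
    by_cases hl : l = 0 <;> simp [smallBit, hl]
  · simp [smallBit, bitAt_zero]
  · have := bitAt_two_pow (s' := s) (.inl rfl) 0 l
    rw [pow_zero, mul_one] at this
    rw [this]
    by_cases hl : l = 0 <;> simp [smallBit, hl]

theorem mcGadget_entry (t t' j₁ j₂ e : ℕ) (v : MCVar) :
    -1 ≤ (mcGadget t t' j₁ j₂).getD e 0 v ∧ (mcGadget t t' j₁ j₂).getD e 0 v ≤ 1 := by
  have hxx : ∀ u u' : MCVar, -1 ≤ (Pi.single u 1 - Pi.single u' 1 : MCVar → ℤ) v ∧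
      (Pi.single u 1 - Pi.single u' 1 : MCVar → ℤ) v ≤ 1 := by
    intro u u'
    rw [Pi.sub_apply, Pi.single_apply, Pi.single_apply]
    split_ifs <;> simp
  have hxy : ∀ i j : ℕ, -1 ≤ (Pi.single (MCVar.x i) 1 - Pi.single (MCVar.y i) 1 -
      (Pi.single (MCVar.x j) 1 - Pi.single (MCVar.y j) 1) : MCVar → ℤ) v ∧
      (Pi.single (MCVar.x i) 1 - Pi.single (MCVar.y i) 1 -
        (Pi.single (MCVar.x j) 1 - Pi.single (MCVar.y j) 1) : MCVar → ℤ) v ≤ 1 := by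
    intro i j
    simp only [Pi.sub_apply, Pi.single_apply]
    cases v <;> simp only [MCVar.x.injEq, MCVar.y.injEq, reduceCtorEq, if_false] <;>
      split_ifs <;> simp
  rcases Nat.lt_or_ge e 8 with he | he
  · interval_cases e
    · exact hxx _ _
    · exact hxx _ _
    · exact hxx _ _
    · exact hxx _ _
    · exact hxx _ _
    · exact hxx _ _
    · exact hxy _ _
    · exact hxy _ _
  · rw [List.getD_eq_default _ _ (by exact he)]
    simp

/-- A transformed row is represented by its output bits. -/
theorem signMag_rowBit {x : PRInput n m w → Bool} (hA : IsGz2 (inputMatrix x))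
    (hw : IsWBounded w (inputMatrix x)) (ng₀ : ℕ) (i : Fin m) (C : ℕ) :
    signMag (fun b => rowBit (i + 1) C b x) =
        (prRun w (inputMatrix x) ng₀).A (i + 1) C ∧
      ((∃ b, rowBit (i + 1) C b x = true) → 1 ≤ C ∧ C ≤ n + numPairs (inputEntry x) n m w) := by
  obtain ⟨K, hK, h⟩ := bitAt_final hA hw ng₀ i
  have key : ∀ r : ℕ, r / 2 = i → ∀ l ≤ w,
      bitAt ((prRun w (inputMatrix x) ng₀).A (i + 1) C) (lineSign r) l = isFinalEntry x r l C ∧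
      (isFinalEntry x r l C = true → 1 ≤ C ∧ C ≤ n + numPairs (inputEntry x) n m w) := by
    intro r hr l hl
    obtain ⟨h1, ⟨p, hp, hp1, hp2⟩, h3⟩ := h r hr
    rw [h3, isFinalEntry, hp, inputEntry]
    have h1l := h1 l hl
    by_cases hlK : l = K
    · subst hlK
      rw [hp]
      simp only [List.length_singleton, decide_true, Bool.true_and, List.getD_cons_zero, true_and,
        List.mem_singleton]
      refine ⟨?_, fun h => ?_⟩
      · rw [decide_eq_decide]
        exact eq_comm
      · rw [decide_eq_true_iff] at h
        subst h
        exact ⟨hp1, hp2⟩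
    · simp [hlK, h1l]
  have hbig : ∀ s, s = 1 ∨ s = -1 → ∀ l, w < l →
      bitAt ((prRun w (inputMatrix x) ng₀).A (i + 1) C) s l = false := by
    intro s hs l hl
    obtain ⟨r, hr, rfl⟩ : ∃ r : ℕ, r / 2 = i ∧ lineSign r = s := by
      rcases hs with rfl | rfl
      · exact ⟨2 * i, by omega, by simp [lineSign]⟩
      · exact ⟨2 * i + 1, by omega, by simp [lineSign]⟩
    rw [(h r hr).2.2]
    exact decide_eq_false fun h => by omega
  have k1 := key (2 * i) (by omega)
  have k2 := key (2 * i + 1) (by omega)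
  have e1 : lineSign (2 * i) = 1 := by simp [lineSign]
  have e2 : lineSign (2 * i + 1) = -1 := by simp [lineSign]
  rw [e1] at k1
  rw [e2] at k2
  have hbit : ∀ l (hl : l < w + 1), rowBit (i + 1) C (Fin.succ ⟨l, hl⟩) x =
      (isFinalEntry x (2 * i) l C || isFinalEntry x (2 * i + 1) l C) := by
    intro l hl
    rw [rowBit, if_neg (Fin.succ_ne_zero _)]
    simp
  have hsign : rowBit (i + 1) C (0 : Fin (w + 2)) x =
      (List.range (w + 1)).any fun l => isFinalEntry x (2 * i + 1) l C := by
    rw [rowBit, if_pos rfl, Nat.add_sub_cancel]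
  constructor
  · refine eq_of_bitAt_eq fun s hs l => ?_
    rw [bitAt_signMag]
    by_cases hl : l < w + 1
    swap
    · rw [dif_neg hl, Bool.and_false, hbig s hs l (by omega)]
    rw [dif_pos hl, hbit, hsign, ← (k1 l (by omega)).1, ← (k2 l (by omega)).1]
    by_cases hneg : (List.range (w + 1)).any (fun l => isFinalEntry x (2 * i + 1) l C) = true
    · rw [if_pos hneg]
      obtain ⟨l', hl', hf⟩ := List.any_eq_true.1 hneg
      rw [← (k2 l' (by have := List.mem_range.1 hl'; omega)).1, bitAt, Bool.and_eq_true,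
        decide_eq_true_iff] at hf
      rcases hs with rfl | rfl <;> simp [bitAt, hf.1]
    · rw [if_neg hneg]
      have hf : bitAt ((prRun w (inputMatrix x) ng₀).A (i + 1) C) (-1) l = false := by
        rw [(k2 l (by omega)).1, ← Bool.not_eq_true]
        exact fun hf => hneg (List.any_eq_true.2 ⟨l, List.mem_range.2 hl, hf⟩)
      rw [hf]
      rcases hs with rfl | rfl
      · simp
      · simp [hf]
  · rintro ⟨b, hb⟩
    induction b using Fin.cases with
    | zero =>
      rw [hsign] at hb
      obtain ⟨l, hl, hf⟩ := List.any_eq_true.1 hb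
      exact (k2 l (by have := List.mem_range.1 hl; omega)).2 hf
    | succ l =>
      obtain ⟨l, hl⟩ := l
      rw [hbit, Bool.or_eq_true] at hb
      rcases hb with hb | hb
      · exact (k1 l (by omega)).2 hb
      · exact (k2 l (by omega)).2 hb

theorem signMag_outBit {x : PRInput n m w → Bool} (hA : IsGz2 (inputMatrix x))
    (hw : IsWBounded w (inputMatrix x)) (r : Fin (prRows w (inputMatrix x)))
    (q : Fin (prCols w (inputMatrix x))) :
    signMag (fun b => outBit (r + 1) (q + 1) b x) = prMatrix w (inputMatrix x) r q := by
  have hr := r.2.trans_eq (prRows_eq w _)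
  have hq := q.2.trans_eq (prCols_eq w _)
  change r.1 < m + 8 * numPairs (inputEntry x) n m w at hr
  change q.1 < 2 * (n + 5 * numPairs (inputEntry x) n m w) at hq
  unfold outBit
  rcases Nat.lt_or_ge r.1 m with hrm | hrm
  · simp only [if_pos (show 1 ≤ r.1 + 1 ∧ r.1 + 1 ≤ m by omega)]
    obtain ⟨h1, h2⟩ := signMag_rowBit hA hw (prRun w (inputMatrix x) 0).cols ⟨r, hrm⟩ (q + 1)
    rw [prMatrix_top r q hrm]
    split_ifs with hqN
    · exact h1
    · refine signMag_zero fun b => ?_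
      rw [← Bool.not_eq_true]
      intro hb
      have := (h2 ⟨b, hb⟩).2
      rw [inputEntry] at this
      omega
  · simp only [if_neg (show ¬ (1 ≤ r.1 + 1 ∧ r.1 + 1 ≤ m) by omega)]
    rw [prMatrix_bot r q hrm]
    simp only [if_pos (show m < r.1 + 1 ∧ r.1 + 1 ≤ m + 8 * numPairs (inputEntry x) n m w ∧
      1 ≤ q.1 + 1 ∧ q.1 + 1 ≤ 2 * (n + 5 * numPairs (inputEntry x) n m w) by omega),
      Nat.add_sub_cancel]
    exact signMag_smallBit (mcGadget_entry _ _ _ _ _ _).1 (mcGadget_entry _ _ _ _ _ _).2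

theorem signMag_outBit_outside {x : PRInput n m w → Bool} (hA : IsGz2 (inputMatrix x))
    (hw : IsWBounded w (inputMatrix x)) {R C : ℕ} (h : ¬ (1 ≤ R ∧ R ≤ prRows w (inputMatrix x) ∧
      1 ≤ C ∧ C ≤ prCols w (inputMatrix x))) :
    signMag (fun b => outBit R C b x) = 0 := by
  rw [prRows_eq, prCols_eq] at h
  refine signMag_zero fun b => ?_
  unfold outBit inputEntry
  split_ifs with h1 h2
  · rw [← Bool.not_eq_true]
    intro hb
    obtain ⟨R, rfl⟩ : ∃ R', R = R' + 1 := ⟨R - 1, by omega⟩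
    have := (signMag_rowBit hA hw 0 ⟨R, by omega⟩ C).2 ⟨b, hb⟩
    rw [inputEntry] at this
    omega
  · omega
  · rfl

end OutputBits

/-! ### Size bounds -/

theorem two_pow_size_le {N : ℕ} (hN : 0 < N) : 2 ^ N.size ≤ 2 * N := by
  have hpos := Nat.size_pos.2 hN
  have h : 2 ^ (N.size - 1) ≤ N := Nat.lt_size.1 (by omega)
  calc 2 ^ N.size = 2 ^ (N.size - 1) * 2 := by rw [← pow_succ, Nat.sub_add_cancel hpos]
    _ ≤ 2 * N := by omega

theorem sizeBound {n m w : ℕ} (hn : 0 < n) (hm : 0 < m) (hw : 0 < w) :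
    SizeBound n m w (64 * (n + m + w) ^ 4) := by
  obtain ⟨T, hT⟩ : ∃ T, T = n + m + w := ⟨_, rfl⟩
  rw [← hT]
  have hn' : n ≤ T := by omega
  have hm' : m ≤ T := by omega
  have hw' : w + 1 ≤ T := by omega
  have hwT : w ≤ T := by omega
  have h1 : 1 ≤ T := by omega
  have hT3 : T ≤ T ^ 3 := Nat.le_self_pow (by omega) T
  have hT4 : T ^ 3 < T ^ 4 := Nat.pow_lt_pow_right (by omega) (by omega)
  have hmwn : m * w * n ≤ T ^ 3 := by
    calc m * w * n ≤ T * T * T := by gcongr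
      _ = T ^ 3 := by ring
  have hwn : w * (n * n) ≤ T ^ 3 := by
    calc w * (n * n) ≤ T * (T * T) := by gcongr
      _ = T ^ 3 := by ring
  have hnn : n * n ≤ w * (n * n) := Nat.le_mul_of_pos_left _ hw
  have hsz : n * 2 ^ n.size ≤ 2 * (n * n) := by
    calc n * 2 ^ n.size ≤ n * (2 * n) := Nat.mul_le_mul_left _ (two_pow_size_le hn)
      _ = 2 * (n * n) := by ring
  have hwsz : w * (n * 2 ^ n.size) ≤ 2 * (w * (n * n)) := by
    calc w * (n * 2 ^ n.size) ≤ w * (2 * (n * n)) := Nat.mul_le_mul_left _ hsz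
      _ = 2 * (w * (n * n)) := by ring
  have hmw : m * w ≤ m * w * n := Nat.le_mul_of_pos_right _ hn
  have hidx : 2 ^ idxBits n m w ≤ 2 * (32 * (n * m * w)) := two_pow_size_le (by positivity)
  have e1 : n * m * w = m * w * n := by ring
  rw [e1] at hidx
  refine ⟨by omega, by omega, ?_, ?_, by omega, by omega, by omega⟩
  · rw [Nat.mul_assoc]
    omega
  · rw [Nat.mul_assoc 2, Nat.mul_assoc 2]
    omega

theorem numPairs_le (a : ℕ → ℕ → ℤ) (n m w : ℕ) : numPairs a n m w ≤ 2 * (n * m * w) :=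
  (blockOff_le a n w _).trans (le_of_eq (by ring))

/-- Circuits for the output bits, of constant depth and polynomial size. -/
theorem exists_circuit {n m w : ℕ} (hn : 0 < n) (hm : 0 < m) (hw : 0 < w) :
    ∃ C : TCCircuit (PRInput n m w) (Fin (w + 2)),
      (∀ x b, C.eval x b = outBit (inputRow x) (inputCol x) b x) ∧ C.depth ≤ 262 ∧
        C.size ≤ (n + m + w) ^ 2621 := by
  obtain ⟨C, hC, hd, hs⟩ := TCCircuit.exists_eval_eq (tc_output (sizeBound hn hm hw) hw)
  refine ⟨C, hC, hd, hs.trans ?_⟩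
  obtain ⟨T, hT⟩ : ∃ T, T = n + m + w := ⟨_, rfl⟩
  rw [← hT]
  have h3 : 3 ≤ T := by omega
  have h4 : 1 ≤ T ^ 4 := Nat.one_le_pow _ _ (by omega)
  have h6 : 729 ≤ T ^ 6 := (by norm_num : 729 = 3 ^ 6) ▸ Nat.pow_le_pow_left h3 6
  have hbase : 2 * (4 * (64 * T ^ 4) + 10) + 3 ≤ T ^ 10 := by
    calc 2 * (4 * (64 * T ^ 4) + 10) + 3 ≤ 729 * T ^ 4 := by omega
      _ ≤ T ^ 6 * T ^ 4 := Nat.mul_le_mul_right _ h6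
      _ = T ^ 10 := by rw [← pow_add]
  rw [show 2621 = 10 * 262 + 1 by norm_num]
  -- The exponent is kept symbolic, so that no power is evaluated.
  generalize 262 = D
  calc (w + 2) * (2 * (4 * (64 * T ^ 4) + 10) + 3) ^ D ≤ T * (T ^ 10) ^ D :=
        Nat.mul_le_mul (by omega) (Nat.pow_le_pow_left hbase _)
    _ = T ^ (10 * D + 1) := by rw [← pow_mul, ← pow_succ']

theorem exists_inputMatrix_eq {n m w : ℕ} {A : Matrix (Fin m) (Fin n) ℤ} (hA : IsGz2 A)
    (hw : IsWBounded w A) : ∃ x : PRInput n m w → Bool, inputMatrix x = A := by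
  refine ⟨Sum.elim (fun t => if t.2.2 = 0 then decide (A t.1 t.2.1 < 0)
    else (A t.1 t.2.1).natAbs.testBit (t.2.2 - 1)) fun _ => false, ?_⟩
  ext i j
  simp only [inputMatrix, signMag, Sum.elim_inl, if_true, Fin.succ_ne_zero, if_false,
    Fin.val_succ, Nat.add_sub_cancel]
  rw [Nat.ofBits_testBit, Nat.mod_eq_of_lt (natAbs_lt hA hw i j)]
  rcases lt_or_ge (A i j) 0 with h | h
  · simp [h, abs_of_neg h]
  · simp [not_lt.2 h, abs_of_nonneg h]

theorem idxBits_le (n m w : ℕ) :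
    idxBits n m w ≤ Nat.log 2 (n * m * w) + 6 := by
  rw [idxBits, Nat.size_le]
  calc 32 * (n * m * w) < 32 * 2 ^ (Nat.log 2 (n * m * w) + 1) :=
        Nat.mul_lt_mul_of_pos_left (Nat.lt_pow_succ_log_self (by omega) _) (by omega)
    _ = 2 ^ (Nat.log 2 (n * m * w) + 6) := by rw [pow_succ, pow_add]; ring

theorem mainTheorem4 :
    ∃ (C : ∀ n m w : ℕ, TCCircuit (PRInput n m w) (Fin (w + 2))) (d c : ℕ),
      ∀ n m w : ℕ, 0 < n → 0 < m → 0 < w →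
        (C n m w).depth ≤ d ∧
        (C n m w).size ≤ (n + m + w) ^ c ∧
        Fintype.card (Fin m × Fin n × Fin (w + 2)) ≤ c * (n * m * w) ∧
        idxBits n m w ≤ c * (Nat.log 2 (n * m * w) + 1) ∧
        w + 2 ≤ c * w ∧
        (∀ A : Matrix (Fin m) (Fin n) ℤ, IsGz2 A → IsWBounded w A →
          prRows w A ≤ c * (n * m * w) ∧ prCols w A ≤ c * (n * m * w) ∧
          prRows w A < 2 ^ idxBits n m w ∧ prCols w A < 2 ^ idxBits n m w ∧
          IsMC2 (prMatrix w A) ∧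
          ∃ x : PRInput n m w → Bool, inputMatrix x = A) ∧
        ∀ x : PRInput n m w → Bool,
          IsGz2 (inputMatrix x) → IsWBounded w (inputMatrix x) →
          (∀ (r : Fin (prRows w (inputMatrix x))) (q : Fin (prCols w (inputMatrix x))),
            inputRow x = r.1 + 1 → inputCol x = q.1 + 1 →
              signMag ((C n m w).eval x) = prMatrix w (inputMatrix x) r q) ∧
          (¬ (1 ≤ inputRow x ∧ inputRow x ≤ prRows w (inputMatrix x) ∧
              1 ≤ inputCol x ∧ inputCol x ≤ prCols w (inputMatrix x)) →
            signMag ((C n m w).eval x) = 0) := by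
  have hex : ∀ n m w : ℕ, ∃ C : TCCircuit (PRInput n m w) (Fin (w + 2)),
      0 < n → 0 < m → 0 < w →
        (∀ x b, C.eval x b = outBit (inputRow x) (inputCol x) b x) ∧ C.depth ≤ 262 ∧
          C.size ≤ (n + m + w) ^ 2621 := by
    intro n m w
    by_cases h : 0 < n ∧ 0 < m ∧ 0 < w
    · obtain ⟨C, hC⟩ := exists_circuit h.1 h.2.1 h.2.2
      exact ⟨C, fun _ _ _ => hC⟩
    · obtain ⟨C, -⟩ := TCCircuit.exists_eval_eq (ι := PRInput n m w) (F := 0) (N := w + 2)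
        fun _ => TCComp.const (D := 0) false
      exact ⟨C, fun h1 h2 h3 => absurd ⟨h1, h2, h3⟩ h⟩
  choose C hC using hex
  refine ⟨C, 262, 2621, fun n m w hn hm hw => ?_⟩
  obtain ⟨heval, hd, hs⟩ := hC n m w hn hm hw
  have hnle : n ≤ n * m * w := by
    rw [Nat.mul_assoc]
    exact Nat.le_mul_of_pos_right _ (by positivity)
  have hmle : m ≤ n * m * w := by
    rw [Nat.mul_comm n, Nat.mul_assoc]
    exact Nat.le_mul_of_pos_right _ (by positivity)
  refine ⟨hd, hs, ?_, ?_, by omega, fun A hA hAw => ?_, fun x hA hAw => ?_⟩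
  · simp only [Fintype.card_prod, Fintype.card_fin]
    calc m * (n * (w + 2)) ≤ m * (n * (3 * w)) := by gcongr; omega
      _ = 3 * (n * m * w) := by ring
      _ ≤ 2621 * (n * m * w) := Nat.mul_le_mul_right _ (by norm_num)
  · have := idxBits_le n m w
    omega
  · have hG := numPairs_le (oneBased A) n m w
    have hidx : 32 * (n * m * w) < 2 ^ idxBits n m w := Nat.lt_size_self _
    have hrows := prRows_eq w A
    have hcols := prCols_eq w A
    exact ⟨by omega, by omega, by omega, by omega, prMatrix_isMC2 hA hAw,
      exists_inputMatrix_eq hA hAw⟩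
  · have hfun : (C n m w).eval x = fun b => outBit (inputRow x) (inputCol x) b x :=
      funext (heval x)
    rw [hfun]
    refine ⟨fun r q hr hq => ?_, fun h => signMag_outBit_outside hA hAw h⟩
    rw [hr, hq]
    exact signMag_outBit hA hAw r q
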